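/- **Theorem 4.1.** Let $H$ be a real separable Hilbert space, $\mathscr B(H)$ its Borel $\sigma$-algebra, $\widehat\mu(a)=\int_H e^{i\langle a,x\rangle}\mu(dx)$, and let $T>0$. The Sazonov topology on $H$ is the one generated by the seminorms $a\mapsto\|Sa\|$, $S$ Hilbert–Schmidt. Assume: * (H1) $(U_{s,t})_{s\le t}$, $s,t\in\mathbb R$, are uniformly bounded linear operators on $H$ with $U_{t,t}=I$, $U_{r,t}U_{s,r}=U_{s,t}$ for $s\le r\le t$, and $(s,t)\mapsto U_{s,t}x$ is continuous on $\{s\le t\}$ for every $x\in H$. * (H2) $\sigma:\mathbb R\to\mathcal L(H)$ is strongly continuous and bounded in operator norm. * (H3) $\lambda:H\to\mathbb C$ is norm-continuous with $\lambda(0)=0$ and negative definite, i.e. $\lambda(-a)=\overline{\lambda(a)}$ for all $a\in H$, and $\sum_{i,j=1}^n\lambda(a_i-a_j)c_i\overline{c_j}\le 0$ for all $n$, $a_i\in H$, $c_i\in\mathbb C$ with $\sum_i c_i=0$. * (H4) For all $t\in\mathbb R$ and $a\in H$, $r\mapsto\lambda(\sigma(r)^*U_{r,t}^*a)$ is Lebesgue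 integrable on $(-\infty,t)$; for all $t$ the function $a\mapsto\exp\big[-\int_{-\infty}^t\lambda(\sigma(r)^*U_{r,t}^*a)\,dr\big]$ is Sazonov continuous; and the probability measure $\mu_{-\infty,t}$ on $(H,\mathscr B(H))$ whose characteristic function is this function has finite weak first moments, i.e. $\int_H|\langle a,x\rangle|\,\mu_{-\infty,t}(dx)<\infty$ for all $a\in H$. * (H5) $\lambda=\overline\lambda$. For $s\le t$ let $\mu_{s,t}$ be the probability measure on $H$ with $\widehat{\mu_{s,t}}(a)=\exp\big[-\int_s^t\lambda(\sigma(r)^*U_{r,t}^*a)\,dr\big]$, $a\in H$, and let $\pi_{s,t}(x,\cdot)$ be the image of $\mu_{s,t}$ under $y\mapsto y+U_{s,t}x$. (Under (H1)–(H4) the measures $\mu_{-\infty,t}$ and $\mu_{s,t}$ exist and are unique.) Let $\mathcal K^1(\pi)$ be the set of all families $(\nu_t)_{t\in\mathbb R}$ of probability measures on $(H,\mathscr B(H))$ such that $\int_H\pi_{s,t}(x,B)\,\nu_s(dx)=\nu_t(B)$ for all $s\le t$, $B\in\mathscr B(H)$, and $\int_H|\langle a,x\rangle|\,\nu_t(dx)<\infty$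 for all $t\in\mathbb R$, $a\in H$. Suppose that $U_{s+T,t+T}=U_{s,t}$ for all $s\le t$ and $\sigma(t+T)=\sigma(t)$ for all $t$, and that there are $c,\omega\in(0,\infty)$ with $\|U_{s,t}\|_{\mathcal L(H)}\le c\,e^{-\omega(t-s)}$ for all $s\le t$. Then $(\mu_{-\infty,t})_{t\in\mathbb R}$ belongs to $\mathcal K^1(\pi)$ and is $T$-periodic ($\mu_{-\infty,t+T}=\mu_{-\infty,t}$ for all $t$), and it is the only $T$-periodic element of $\mathcal K^1(\pi)$. -/

import Mathlib

open MeasureTheory Set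
open scoped ComplexOrder ComplexConjugate RealInnerProductSpace

namespace Mehler

universe u

section Hilbert

variable {H : Type u} [NormedAddCommGroup H] [InnerProductSpace ℝ H] [CompleteSpace H]

/-- A bounded operator `S` is Hilbert-Schmidt if `∑ ‖S e‖ ^ 2 < ∞` along an orthonormal basis. -/
def IsHilbertSchmidt (S : H →L[ℝ] H) : Prop :=
  ∃ (w : Set H) (e : HilbertBasis w ℝ H), Summable fun i => ‖S (e i)‖ ^ 2

/-- The Sazonov topology, generated by the seminorms `a ↦ ‖S a‖` with `S` Hilbert-Schmidt:
the coarsest topology finer than each of the topologies of these seminorms (the topology of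
the seminorm `a ↦ ‖S a‖` is the one induced by `S` from the norm topology). -/
@[reducible] def sazonovTopology (H : Type u) [NormedAddCommGroup H] [InnerProductSpace ℝ H]
    [CompleteSpace H] : TopologicalSpace H :=
  ⨅ S : {S : H →L[ℝ] H // IsHilbertSchmidt S},
    TopologicalSpace.induced (fun a => S.1 a) UniformSpace.toTopologicalSpace

def SazonovContinuous (φ : H → ℂ) : Prop :=
  @Continuous H ℂ (sazonovTopology H) _ φ

/-- Negative definite functions; in the order of `ℂ`, `z ≤ 0` means that `z` is real and
nonpositive. -/
structure IsNegativeDefinite (φ : H → ℂ) : Prop where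
  zero_nonneg : 0 ≤ φ 0
  hermitian : ∀ a, φ (-a) = conj (φ a)
  sum_nonpos : ∀ (n : ℕ) (a : Fin n → H) (c : Fin n → ℂ), ∑ i, c i = 0 →
    ∑ i, ∑ j, φ (a i - a j) * c i * conj (c j) ≤ 0

/-- Strong evolution families of uniformly bounded linear operators. The value `U s t` matters
for `s ≤ t` only. -/
structure IsEvolutionFamily (U : ℝ → ℝ → H →L[ℝ] H) : Prop where
  refl : ∀ t, U t t = ContinuousLinearMap.id ℝ H
  comp : ∀ s r t, s ≤ r → r ≤ t → (U r t).comp (U s r) = U s t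
  strongly_continuous : ∀ x, ContinuousOn (fun p : ℝ × ℝ => U p.1 p.2 x) {p | p.1 ≤ p.2}
  bounded : ∃ C : ℝ, ∀ s t, s ≤ t → ‖U s t‖ ≤ C

/-- Strongly continuous operator functions that are bounded in operator norm. -/
structure IsBoundedCoefficient (σ : ℝ → H →L[ℝ] H) : Prop where
  strongly_continuous : ∀ x, Continuous fun r => σ r x
  bounded : ∃ C : ℝ, ∀ r, ‖σ r‖ ≤ C

/-- Continuous negative definite functions vanishing at `0`. -/
structure IsLevySymbol (lam : H → ℂ) : Prop where
  negativeDefinite : IsNegativeDefinite lam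
  continuous : Continuous lam
  zero : lam 0 = 0

/-- The function `r ↦ λ(σ(r)^* U_{r,t}^* a)`. -/
noncomputable def integrand (U : ℝ → ℝ → H →L[ℝ] H) (σ : ℝ → H →L[ℝ] H) (lam : H → ℂ)
    (t : ℝ) (a : H) (r : ℝ) : ℂ :=
  lam ((σ r).adjoint ((U r t).adjoint a))

/-- `a ↦ exp (- ∫_s^t λ(σ(r)^* U_{r,t}^* a) dr)`. -/
noncomputable def symbolExp (U : ℝ → ℝ → H →L[ℝ] H) (σ : ℝ → H →L[ℝ] H) (lam : H → ℂ)
    (s t : ℝ) (a : H) : ℂ :=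
  Complex.exp (-∫ r in s..t, integrand U σ lam t a r)

/-- `a ↦ exp (- ∫_{-∞}^t λ(σ(r)^* U_{r,t}^* a) dr)`. -/
noncomputable def symbolExpInf (U : ℝ → ℝ → H →L[ℝ] H) (σ : ℝ → H →L[ℝ] H) (lam : H → ℂ)
    (t : ℝ) (a : H) : ℂ :=
  Complex.exp (-∫ r in Iio t, integrand U σ lam t a r)

/-- `U_{s+T,t+T} = U_{s,t}` for `s ≤ t`. -/
def PeriodicEvolution (U : ℝ → ℝ → H →L[ℝ] H) (T : ℝ) : Prop :=
  ∀ s t, s ≤ t → U (s + T) (t + T) = U s t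

variable [MeasurableSpace H]

open Classical in
/-- The probability measure with characteristic function `φ`. If there is none, the value is the
zero measure, which is not a probability measure. -/
noncomputable def measureOfCharFun (φ : H → ℂ) : Measure H :=
  if h : ∃ μ : Measure H, IsProbabilityMeasure μ ∧ ∀ a, charFun μ a = φ a then h.choose else 0

/-- `μ_{s,t}`. -/
noncomputable def mu (U : ℝ → ℝ → H →L[ℝ] H) (σ : ℝ → H →L[ℝ] H) (lam : H → ℂ)
    (s t : ℝ) : Measure H :=
  measureOfCharFun (symbolExp U σ lam s t)

/-- `μ_{-∞,t}`. -/
noncomputable def muInf (U : ℝ → ℝ → H →L[ℝ] H) (σ : ℝ → H →L[ℝ] H) (lam : H → ℂ)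
    (t : ℝ) : Measure H :=
  measureOfCharFun (symbolExpInf U σ lam t)

/-- The generalized Mehler semigroup: `π_{s,t}(x, ·)` is the translate of `μ_{s,t}` by
`U_{s,t} x`. -/
noncomputable def mehler (U : ℝ → ℝ → H →L[ℝ] H) (σ : ℝ → H →L[ℝ] H) (lam : H → ℂ)
    (s t : ℝ) (x : H) : Measure H :=
  (mu U σ lam s t).map fun y => y + U s t x

def FiniteWeakFirstMoments (ν : Measure H) : Prop :=
  ∀ a : H, Integrable (fun x => ⟪a, x⟫) ν

/-- The set `K(π)` of probability entrance laws of a family `π`. -/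
def entranceLaws (π : ℝ → ℝ → H → Measure H) : Set (ℝ → Measure H) :=
  {ν | (∀ t, IsProbabilityMeasure (ν t)) ∧
    ∀ s t, s ≤ t → ∀ B, MeasurableSet B → ∫⁻ x, π s t x B ∂(ν s) = ν t B}

/-- The set `K¹(π)` of probability entrance laws with finite weak first moments. -/
def entranceLaws1 (π : ℝ → ℝ → H → Measure H) : Set (ℝ → Measure H) :=
  {ν | ν ∈ entranceLaws π ∧ ∀ t, FiniteWeakFirstMoments (ν t)}

/-- Integrability on `(-∞, t)`, Sazonov continuity of the exponential, and finite weak first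
moments of `μ_{-∞,t}`. -/
structure HasLimitMeasures (U : ℝ → ℝ → H →L[ℝ] H) (σ : ℝ → H →L[ℝ] H) (lam : H → ℂ) :
    Prop where
  integrable : ∀ t a, IntegrableOn (integrand U σ lam t a) (Iio t)
  sazonov : ∀ t, SazonovContinuous (symbolExpInf U σ lam t)
  moments : ∀ t, FiniteWeakFirstMoments (muInf U σ lam t)

end Hilbert

end Mehler

/-! On characteristic functions, the entrance law equation reads `ν̂_t(a) = ν̂_s(U_{s,t}^* a) ·
exp(-∫_s^t λ(σ(r)^* U_{r,t}^* a) dr)` for `s ≤ t` (`mem_entranceLaws_mehler_iff`). The measures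
`μ_{-∞,t}` satisfy it because the integral over `(-∞,t)` splits at `s` and `U_{r,t}^* = U_{r,s}^*
U_{s,t}^*` (`symbolExpInf_eq_mul`); they are periodic by translation invariance of Lebesgue measure.
For uniqueness, take `s = t - nT`: a periodic solution satisfies `ν̂_t(a) = ν̂_t(U_{t-nT,t}^* a) ·
exp(-∫_{t-nT}^t ...)`. Exponential stability sends the argument to `0`, so the first factor tends to
`1` and the second to the characteristic function of `μ_{-∞,t}`.

Most of the work is the existence of `μ_{s,t}` and `μ_{-∞,t}`, which is proved here and not assumed.
Schoenberg's theorem makes the candidate functions positive definite, and the Minlos-Sazonov theorem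
(`IsPositiveDefinite.exists_charFun_eq`) then produces the measures: Bochner's theorem gives
finite-dimensional approximations, and Sazonov continuity at `0` makes them tight. Since `λ` is
real, hence nonnegative, the symbol of `μ_{s,t}` is dominated by that of `μ_{-∞,t}` and inherits the
required continuity at `0` (`exists_charFun_eq_exp_neg_setIntegral`). -/

namespace Matrix

/-! ### Positive semidefinite kernels: Schur powers and exponentials. -/

variable {ι : Type*}

/-- Kernels of the form `f i * conj (f j)` are positive semidefinite. -/
lemma PosSemidef.of_mul_conj (f : ι → ℂ) : (of fun i j => f i * conj (f j)).PosSemidef := by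
  refine ⟨by ext; simp [mul_comm], fun x => ?_⟩
  have : (x.sum fun i xi => x.sum fun j xj =>
      star xi * (of fun i j => f i * conj (f j)) i j * xj)
      = star (∑ i ∈ x.support, conj (f i) * x i) * ∑ i ∈ x.support, conj (f i) * x i := by
    simp only [Finsupp.sum, star_sum, Finset.sum_mul_sum, of_apply]
    refine Finset.sum_congr rfl fun i _ => Finset.sum_congr rfl fun j _ => ?_
    simp
    ring
  rw [this]
  exact star_mul_self_nonneg _

lemma PosSemidef.map_pow {A : Matrix ι ι ℂ} (hA : A.PosSemidef) (k : ℕ) :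
    (of fun i j => A i j ^ k).PosSemidef := by
  induction k with
  | zero => simpa using PosSemidef.of_mul_conj (fun _ : ι => (1 : ℂ))
  | succ k ih =>
    have := ih.hadamard hA
    exact (congrArg PosSemidef (by ext; simp [pow_succ])).mp this

lemma PosSemidef.of_tendsto {A : ℕ → Matrix ι ι ℂ} (hA : ∀ n, (A n).PosSemidef)
    {B : Matrix ι ι ℂ} (h : ∀ i j, Filter.Tendsto (fun n => A n i j) Filter.atTop (nhds (B i j))) :
    B.PosSemidef := by
  refine ⟨?_, fun x => ?_⟩
  · ext i j
    refine tendsto_nhds_unique (((h j i).star).congr fun n => ?_) (h i j)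
    exact (hA n).1.apply i j
  · refine ge_of_tendsto' (x := Filter.atTop) (f := fun n => x.sum fun i xi => x.sum fun j xj =>
      star xi * A n i j * xj) (b := 0) ?_ fun n => (hA n).2 x
    refine tendsto_finsetSum _ fun i _ => tendsto_finsetSum _ fun j _ => ?_
    exact ((h i j).const_mul _).mul_const _

/-- The exponential series has nonnegative coefficients, so its partial sums are nonnegative
combinations of Schur powers, and positivity survives entrywise limits. -/
lemma PosSemidef.map_exp {A : Matrix ι ι ℂ} (hA : A.PosSemidef) :
    (of fun i j => Complex.exp (A i j)).PosSemidef := by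
  refine PosSemidef.of_tendsto
    (A := fun n => ∑ k ∈ Finset.range n, ((k.factorial : ℝ)⁻¹) • of fun i j => A i j ^ k) ?_ ?_
  · intro n
    exact posSemidef_sum _ fun k _ => (hA.map_pow k).smul (by positivity)
  · intro i j
    have := (NormedSpace.expSeries_div_hasSum_exp (A i j)).tendsto_sum_nat
    rw [← Complex.exp_eq_exp_ℂ] at this
    refine this.congr fun n => ?_
    simp [Matrix.sum_apply, div_eq_inv_mul]

end Matrix

/-! ### Positive definite functions. -/

namespace Mehler

variable {H : Type*} [NormedAddCommGroup H]

/-- Positive definite functions, i.e. `(a, b) ↦ φ (a - b)` is a positive semidefinite kernel. -/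
def IsPositiveDefinite (φ : H → ℂ) : Prop :=
  (Matrix.of fun a b : H => φ (a - b)).PosSemidef

namespace IsPositiveDefinite

variable {φ : H → ℂ}

lemma apply_neg (h : IsPositiveDefinite φ) (a : H) : φ (-a) = conj (φ a) := by
  have := Matrix.IsHermitian.apply h.1 0 a
  simpa using this.symm

lemma sum_nonneg (h : IsPositiveDefinite φ) {ι : Type*} [Fintype ι] (a : ι → H) (c : ι → ℂ) :
    0 ≤ ∑ i, ∑ j, conj (c i) * φ (a i - a j) * c j := by
  classical
  have := (Matrix.posSemidef_iff_dotProduct_mulVec.1 (Matrix.PosSemidef.submatrix h a)).2 c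
  convert! this using 1
  simp [dotProduct, Matrix.mulVec, Finset.mul_sum, mul_assoc]

lemma norm_le_one (h : IsPositiveDefinite φ) (h0 : φ 0 = 1) (a : H) : ‖φ a‖ ≤ 1 := by
  by_cases hz : φ a = 0
  · simp [hz]
  -- These weights turn the form into `2‖φ a‖²(1 - ‖φ a‖)`.
  have h1 := h.sum_nonneg ![a, 0] ![φ a, -‖φ a‖]
  simp only [Fin.sum_univ_two, Matrix.cons_val_zero, Matrix.cons_val_one, sub_self, h0, sub_zero,
    zero_sub, h.apply_neg, _root_.map_neg, Complex.conj_ofReal] at h1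
  have h2 : (conj (φ a) * 1 * φ a + conj (φ a) * φ a * -(‖φ a‖ : ℂ) +
      (-(‖φ a‖ : ℂ) * conj (φ a) * φ a + -(‖φ a‖ : ℂ) * 1 * -(‖φ a‖ : ℂ)))
      = ((2 * ‖φ a‖ ^ 2 * (1 - ‖φ a‖) : ℝ) : ℂ) := by
    have : conj (φ a) * φ a = ((‖φ a‖ ^ 2 : ℝ) : ℂ) := by
      rw [mul_comm, Complex.mul_conj, Complex.normSq_eq_norm_sq]
    push_cast at this ⊢
    linear_combination (2 - 2 * (‖φ a‖ : ℂ)) * this - this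
  rw [h2, Complex.zero_le_real] at h1
  have h3 : 0 < ‖φ a‖ := norm_pos_iff.2 hz
  by_contra! hlt
  nlinarith [mul_pos h3 h3]

/-- Positivity on the points `a, b, 0` with weights `xw, -xw, -1` bounds a quadratic polynomial in
the real variable `x` from below by `0`; a good choice of `x` gives the inequality. It reduces
continuity to continuity at `0`. -/
lemma norm_sub_sq_le (h : IsPositiveDefinite φ) (h0 : φ 0 = 1) (a b : H) :
    ‖φ a - φ b‖ ^ 2 ≤ 2 * ‖1 - φ (a - b)‖ := by
  set w := φ a - φ b with hw
  set d := 1 - φ (a - b) with hd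
  by_cases hz : w = 0
  · simp [hz]
  have key (x : ℝ) : 0 ≤ 2 * ‖d‖ * ‖w‖ ^ 2 * x ^ 2 - 2 * ‖w‖ ^ 2 * x + 1 := by
    have h1 := h.sum_nonneg ![a, b, 0] ![x * w, -(x * w), -1]
    have e1 : φ (b - a) = conj (φ (a - b)) := by rw [← h.apply_neg, neg_sub]
    have hww : conj w * w = ((‖w‖ ^ 2 : ℝ) : ℂ) := by
      rw [mul_comm, Complex.mul_conj, Complex.normSq_eq_norm_sq]
    have h2 := (Complex.le_def.1 h1).1
    have h3 : ∑ i, ∑ j, conj ((![x * w, -(x * w), -1] : Fin 3 → ℂ) i) *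
        φ (![a, b, 0] i - ![a, b, 0] j) * (![x * w, -(x * w), -1] : Fin 3 → ℂ) j
        = ((‖w‖ ^ 2 * x ^ 2 : ℝ) : ℂ) * (d + conj d) - ((2 * ‖w‖ ^ 2 * x : ℝ) : ℂ) + 1 := by
      have hcd : conj d = 1 - conj (φ (a - b)) := by simp [hd]
      have hcw : conj w = conj (φ a) - conj (φ b) := by simp [hw]
      simp only [Fin.sum_univ_three, Matrix.cons_val_zero, Matrix.cons_val_one, Matrix.cons_val,
        sub_self, h0, sub_zero, zero_sub, h.apply_neg, map_neg, map_mul, Complex.conj_ofReal, e1,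
        map_one]
      push_cast at hww ⊢
      rw [← hww, hcd, hcw, hd, hw]
      ring
    rw [h3] at h2
    simp only [Complex.zero_re, Complex.add_re, Complex.sub_re, Complex.re_ofReal_mul,
      Complex.ofReal_re, Complex.one_re, Complex.conj_re] at h2
    have h4 : d.re ≤ ‖d‖ := Complex.re_le_norm d
    nlinarith [mul_nonneg (sq_nonneg ‖w‖) (sq_nonneg x)]
  have hw0 : 0 < ‖w‖ ^ 2 := by positivity
  have hd0 : 0 ≤ ‖d‖ := norm_nonneg _
  -- For `d = 0` the polynomial is affine and takes the value `-1`, a contradiction; otherwise its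
  -- minimum is at `x = 1 / (2‖d‖)`.
  rcases hd0.eq_or_lt with hd1 | hd1
  · have := key (1 / ‖w‖ ^ 2)
    rw [← hd1] at this
    field_simp at this
    linarith
  · have := key (1 / (2 * ‖d‖))
    field_simp at this
    linarith

lemma continuous (h : IsPositiveDefinite φ) (h0 : φ 0 = 1) (hc : ContinuousAt φ 0) :
    Continuous φ := by
  rw [continuous_iff_continuousAt]
  intro a
  have h1 : Filter.Tendsto (fun b => 2 * ‖1 - φ (b - a)‖) (nhds a) (nhds 0) := by
    have h2 : Filter.Tendsto (fun b => φ (b - a)) (nhds a) (nhds (φ 0)) := by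
      refine hc.tendsto.comp ?_
      have : Continuous fun b => b - a := by fun_prop
      simpa using this.tendsto a
    have := ((h2.const_sub 1).norm).const_mul 2
    simpa [h0] using this
  have h2 : Filter.Tendsto (fun b => ‖φ b - φ a‖ ^ 2) (nhds a) (nhds 0) :=
    squeeze_zero (fun _ => by positivity) (fun b => h.norm_sub_sq_le h0 b a) h1
  have h3 := h2.sqrt
  simp only [Real.sqrt_zero, norm_nonneg, Real.sqrt_sq] at h3
  exact tendsto_iff_norm_sub_tendsto_zero.2 h3

/-- Multiplication by the character `a ↦ exp (-i ⟪a, x⟫)`. -/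
lemma mul_char [InnerProductSpace ℝ H] (h : IsPositiveDefinite φ) (x : H) :
    IsPositiveDefinite fun a => φ a * Complex.exp (-(⟪a, x⟫ * Complex.I)) := by
  have := Matrix.PosSemidef.hadamard h
    (Matrix.PosSemidef.of_mul_conj fun a : H => Complex.exp (-(⟪a, x⟫ * Complex.I)))
  refine (congrArg Matrix.PosSemidef ?_).mp this
  ext a b
  simp only [Matrix.of_apply, Matrix.hadamard_apply, ← Complex.exp_conj, ← Complex.exp_add,
    inner_sub_left]
  congr 2
  simp
  ring

lemma comp_addMonoidHom {E : Type*} [NormedAddCommGroup E]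
    (h : IsPositiveDefinite φ) (L : E →+ H) : IsPositiveDefinite fun a => φ (L a) := by
  have := Matrix.PosSemidef.submatrix h L
  simpa [IsPositiveDefinite, Matrix.submatrix] using this

end IsPositiveDefinite

/-! ### Negative definite functions and Schoenberg's theorem. -/

namespace IsNegativeDefinite

variable {ψ : H → ℂ}

lemma sum_nonpos_fintype (h : IsNegativeDefinite ψ) {ι : Type*} [Fintype ι] (a : ι → H)
    (c : ι → ℂ) (hc : ∑ i, c i = 0) : ∑ i, ∑ j, ψ (a i - a j) * c i * conj (c j) ≤ 0 := by
  let e := (Fintype.equivFin ι).symm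
  have := h.sum_nonpos _ (a ∘ e) (c ∘ e) (by simpa [e.sum_comp c] using hc)
  simp only [Function.comp] at this
  rw [Equiv.sum_comp e (fun i => ∑ j, ψ (a i - a (e j)) * c i * conj (c (e j)))] at this
  convert! this using 2 with i
  exact (Equiv.sum_comp e (fun j => ψ (a i - a j) * c i * conj (c j))).symm

/-- The kernel associated with a negative definite function is positive semidefinite. -/
lemma posSemidef_kernel (h : IsNegativeDefinite ψ) (h0 : ψ 0 = 0) :
    (Matrix.of fun a b : H => ψ a + conj (ψ b) - ψ (a - b)).PosSemidef := by
  refine ⟨?_, fun x => ?_⟩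
  · ext a b
    have := h.hermitian (b - a)
    rw [neg_sub] at this
    simp [this, add_comm]
  -- The extra point `0` carries minus the sum of the other weights, so that the weights add up to
  -- zero; its cross terms produce `ψ a + conj (ψ b)`.
  · have := h.sum_nonpos_fintype (ι := Option x.support) (fun o => o.elim 0 (fun i => (i : H)))
      (fun o => o.elim (-∑ i : x.support, conj (x i)) (fun i => conj (x i)))
      (by simp [Fintype.sum_option])
    simp only [Fintype.sum_option, Option.elim, h0, sub_zero, zero_sub, h.hermitian,
      map_neg, map_sum, Complex.conj_conj, zero_mul, zero_add] at this
    rw [← neg_nonneg] at this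
    refine this.trans_eq ?_
    simp only [Finsupp.sum, ← Finset.sum_coe_sort x.support]
    simp only [Matrix.of_apply, Finset.mul_sum, Finset.sum_mul, Finset.sum_add_distrib,
      ← Finset.sum_neg_distrib, mul_neg, neg_mul, neg_neg, neg_add]
    rw [Finset.sum_comm, ← Finset.sum_add_distrib, ← Finset.sum_add_distrib]
    refine Finset.sum_congr rfl fun i _ => ?_
    rw [← Finset.sum_add_distrib, ← Finset.sum_add_distrib]
    refine Finset.sum_congr rfl fun j _ => ?_
    simp only [RCLike.star_def]
    ring

/-- Schoenberg's theorem. -/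
lemma exp_neg (h : IsNegativeDefinite ψ) (h0 : ψ 0 = 0) :
    IsPositiveDefinite fun a => Complex.exp (-ψ a) := by
  have := Matrix.PosSemidef.hadamard (h.posSemidef_kernel h0).map_exp
    (Matrix.PosSemidef.of_mul_conj fun a : H => Complex.exp (-ψ a))
  refine (congrArg Matrix.PosSemidef ?_).mp this
  ext a b
  simp only [Matrix.of_apply, Matrix.hadamard_apply, ← Complex.exp_conj, ← Complex.exp_add]
  congr 1
  simp
  ring

end IsNegativeDefinite

open Filter Topology ProbabilityTheory

/-! ### Weak limits and characteristic functions. -/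

section Limit

variable {H : Type*} [NormedAddCommGroup H] [InnerProductSpace ℝ H]
  [MeasurableSpace H] [BorelSpace H]

/-- A pointwise limit of characteristic functions of a tight family of probability measures is
a characteristic function. -/
lemma exists_charFun_eq_of_isTightMeasureSet {ι : Type*} {l : Filter ι} [l.NeBot]
    {μ : ι → Measure H} [∀ i, IsProbabilityMeasure (μ i)] (hμ : IsTightMeasureSet (range μ))
    {φ : H → ℂ} (h : ∀ a, Tendsto (fun i => charFun (μ i) a) l (𝓝 (φ a))) :
    ∃ ν : Measure H, IsProbabilityMeasure ν ∧ ∀ a, charFun ν a = φ a := by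
  let P : ι → ProbabilityMeasure H := fun i => ⟨μ i, inferInstance⟩
  have hc : IsCompact (closure (range P)) := by
    refine isCompact_closure_of_isTightMeasureSet (hμ.subset ?_)
    rintro _ ⟨_, ⟨i, rfl⟩, rfl⟩
    exact ⟨i, rfl⟩
  -- Along an ultrafilter finer than `l`, compactness yields a limit without extracting
  -- subsequences.
  let U := Ultrafilter.of l
  have hU : (U : Filter ι) ≤ l := Ultrafilter.of_le l
  obtain ⟨ν, -, hν : Tendsto P U (𝓝 ν)⟩ := hc.ultrafilter_le_nhds (U.map P)
    (.trans (by simp) (monotone_principal subset_closure))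
  refine ⟨ν, inferInstance, fun a => ?_⟩
  rw [ProbabilityMeasure.tendsto_iff_forall_integral_rclike_tendsto ℂ] at hν
  have h1 := hν (BoundedContinuousFunction.innerProbChar a)
  refine tendsto_nhds_unique ?_ ((h a).mono_left hU)
  simp only [charFun_eq_integral_innerProbChar]
  exact h1

end Limit

/-! ### From sums to integrals. -/

section Positivity

variable {H : Type*} [NormedAddCommGroup H] [SecondCountableTopology H]
  [MeasurableSpace H] [BorelSpace H] {φ : H → ℂ}

/-- For `n` independent points with law `γ`, the sum of `φ (x i - x j)` is nonnegative and has
expectation `n + n(n-1)I`. The case `n = 2` shows that `I` is real, and large `n` that it is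
nonnegative. -/
lemma IsPositiveDefinite.integral_prod_nonneg (h : IsPositiveDefinite φ) (h0 : φ 0 = 1)
    (hc : Continuous φ) (γ : Measure H) [IsProbabilityMeasure γ] :
    0 ≤ ∫ p, φ (p.1 - p.2) ∂(γ.prod γ) := by
  set I := ∫ p, φ (p.1 - p.2) ∂(γ.prod γ) with hI
  have key (n : ℕ) : 0 ≤ (n : ℂ) + n * (n - 1) * I := by
    let π := Measure.pi fun _ : Fin n => γ
    have hind : iIndepFun (fun i (x : Fin n → H) => x i) π :=
      iIndepFun_pi (X := fun _ x => x) fun _ => aemeasurable_id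
    have hterm (i j : Fin n) : ∫ x, φ (x i - x j) ∂π = if i = j then 1 else I := by
      split_ifs with hij
      · simp [hij, h0, π]
      · have h1 := (indepFun_iff_map_prod_eq_prod_map_map
          (measurable_pi_apply i).aemeasurable (measurable_pi_apply j).aemeasurable).1 (hind.indepFun hij)
        have h2 (k : Fin n) : π.map (fun x => x k) = γ :=
          (measurePreserving_eval (fun _ : Fin n => γ) k).map_eq
        rw [h2, h2] at h1
        rw [hI, ← h1, integral_map (by fun_prop)
          (Continuous.aestronglyMeasurable (by fun_prop))]
    have hint (i j : Fin n) : Integrable (fun x : Fin n → H => φ (x i - x j)) π :=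
      Integrable.of_bound (Continuous.aestronglyMeasurable (by fun_prop)) 1
        (ae_of_all _ fun x => h.norm_le_one h0 _)
    have h3 : 0 ≤ ∫ x, ∑ i, ∑ j, φ (x i - x j) ∂π := by
      refine integral_nonneg fun x => ?_
      simpa using h.sum_nonneg x (fun _ => 1)
    rw [integral_finsetSum _ fun i _ => integrable_finsetSum _ fun j _ => hint i j] at h3
    simp_rw [integral_finsetSum _ fun j _ => hint _ j, hterm] at h3
    convert! h3 using 1
    have : ∀ i : Fin n, ∑ j : Fin n, (if i = j then 1 else I) = 1 + (n - 1) * I := by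
      intro i
      have : ∀ j : Fin n, (if i = j then 1 else I) = (if i = j then (1 - I) else 0) + I := by
        intro j; split_ifs <;> ring
      simp_rw [this, Finset.sum_add_distrib]
      simp
      ring
    simp_rw [this]
    simp
    ring
  have him : I.im = 0 := by
    have := (Complex.le_def.1 (key 2)).2
    norm_num at this
    linarith
  have hre : 0 ≤ I.re := by
    by_contra! hlt
    obtain ⟨n, hn⟩ := exists_nat_gt (1 / (-I.re))
    have := (Complex.le_def.1 (key (n + 1))).1
    have e : (((n + 1 : ℕ) : ℂ) + (n + 1 : ℕ) * ((n + 1 : ℕ) - 1) * I)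
      = ((n + 1 : ℝ) : ℂ) + ((n + 1) * n : ℝ) * I := by push_cast; ring
    rw [e, Complex.add_re, Complex.re_ofReal_mul, Complex.ofReal_re, Complex.zero_re] at this
    rw [div_lt_iff₀ (by linarith)] at hn
    nlinarith [(Nat.cast_nonneg n : (0 : ℝ) ≤ n)]
  exact Complex.le_def.2 ⟨by simpa using hre, by simp [him]⟩

end Positivity

/-! ### Bochner's theorem in finite dimension. -/

section Bochner

variable {E : Type*} [NormedAddCommGroup E] [InnerProductSpace ℝ E] [FiniteDimensional ℝ E]
  [MeasurableSpace E] [BorelSpace E] {φ : E → ℂ}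

lemma integrable_exp_neg_mul_norm_sq {b : ℝ} (hb : 0 < b) :
    Integrable fun v : E => Real.exp (-b * ‖v‖ ^ 2) := by
  have := (GaussianFourier.integrable_cexp_neg_mul_sq_norm_add (b := b) (by simpa) 0 (0 : E)).norm
  refine this.congr (ae_of_all _ fun v => ?_)
  simp [Complex.norm_exp, ← Complex.ofReal_pow]

lemma integral_exp_neg_mul_norm_sq_pos {b : ℝ} (hb : 0 < b) :
    0 < ∫ v : E, Real.exp (-b * ‖v‖ ^ 2) :=
  integral_exp_pos (integrable_exp_neg_mul_norm_sq hb)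

/-- The difference of two independent Gaussians with density proportional to `exp(-2b‖x‖²)` has
density proportional to `exp(-b‖u‖²)`, so this is `integral_prod_nonneg` for a Gaussian `γ`. -/
lemma IsPositiveDefinite.integral_mul_exp_nonneg (h : IsPositiveDefinite φ) (h0 : φ 0 = 1)
    (hc : Continuous φ) {b : ℝ} (hb : 0 < b) :
    0 ≤ ∫ u, φ u * Real.exp (-b * ‖u‖ ^ 2) := by
  let f : E → ℝ := fun a => -(2 * b) * ‖a‖ ^ 2
  have hf : Integrable fun a => Real.exp (f a) := integrable_exp_neg_mul_norm_sq (by positivity)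
  set Z := ∫ a, Real.exp (f a) with hZ
  have hZ0 : 0 < Z := integral_exp_pos hf
  let γ := (volume : Measure E).tilted f
  have : IsProbabilityMeasure γ := isProbabilityMeasure_tilted hf
  have h1 := h.integral_prod_nonneg h0 hc γ
  rw [integral_prod_symm _ (Integrable.of_bound (Continuous.aestronglyMeasurable (by fun_prop)) 1
        (ae_of_all _ fun x => h.norm_le_one h0 _))] at h1
  simp only [γ, integral_tilted] at h1
  have h2 (y : E) : ∫ x, (Real.exp (f x) / Z) • φ (x - y) =
      ∫ u, (Real.exp (f (u + y)) / Z) • φ u := by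
    rw [← integral_add_right_eq_self _ y]
    simp
  simp_rw [← hZ, h2, ← integral_smul] at h1
  rw [integral_integral_swap] at h1
  · have h3 (u : E) : ∫ y, (Real.exp (f y) / Z) • (Real.exp (f (u + y)) / Z) • φ u =
        ((Z⁻¹ ^ 2 * ∫ y : E, Real.exp (-(4 * b) * ‖y‖ ^ 2) : ℝ) : ℂ) *
          (φ u * Real.exp (-b * ‖u‖ ^ 2)) := by
      have h4 (y : E) : (Real.exp (f y) / Z) • (Real.exp (f (u + y)) / Z) • φ u =
          ((Real.exp (-(4 * b) * ‖y + (1 / 2 : ℝ) • u‖ ^ 2) : ℝ) : ℂ) *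
            ((Z⁻¹ ^ 2 : ℝ) * (φ u * Real.exp (-b * ‖u‖ ^ 2))) := by
        have h5 : Real.exp (f y) * Real.exp (f (u + y)) =
            Real.exp (-(4 * b) * ‖y + (1 / 2 : ℝ) • u‖ ^ 2) * Real.exp (-b * ‖u‖ ^ 2) := by
          rw [← Real.exp_add, ← Real.exp_add]
          congr 1
          simp only [f, norm_add_sq_real, inner_smul_right, norm_smul]
          rw [real_inner_comm]
          norm_num
          ring
        have h6 := congrArg (fun x : ℝ => (x : ℂ)) h5
        simp only [Complex.real_smul, Complex.ofReal_div, Complex.ofReal_mul, Complex.ofReal_pow,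
          Complex.ofReal_inv] at h6 ⊢
        linear_combination (Z⁻¹ : ℂ) ^ 2 * φ u * h6
      simp_rw [h4, integral_mul_const, integral_complex_ofReal]
      rw [integral_add_right_eq_self fun y : E => Real.exp (-(4 * b) * ‖y‖ ^ 2)]
      push_cast
      ring
    simp_rw [h3, integral_const_mul] at h1
    have h7 : 0 < Z⁻¹ ^ 2 * ∫ y : E, Real.exp (-(4 * b) * ‖y‖ ^ 2) :=
      mul_pos (by positivity) (integral_exp_neg_mul_norm_sq_pos (by positivity))
    rw [Complex.le_def, Complex.re_ofReal_mul, Complex.im_ofReal_mul, Complex.zero_re,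
      Complex.zero_im] at h1
    exact Complex.le_def.2 ⟨(mul_nonneg_iff_of_pos_left h7).1 h1.1,
      ((mul_eq_zero_iff_left h7.ne').1 h1.2.symm).symm⟩
  · refine Integrable.mono' (((integrable_exp_neg_mul_norm_sq (E := E) (b := b) hb).mul_prod
      (integrable_exp_neg_mul_norm_sq (E := E) (b := b / 2) (by positivity))).const_mul (Z⁻¹ ^ 2))
      (Continuous.aestronglyMeasurable (by simp only [Function.uncurry_def, f]; fun_prop)) ?_
    refine ae_of_all _ fun p => ?_
    obtain ⟨y, u⟩ := p
    simp only [Function.uncurry_apply_pair, norm_smul, Real.norm_eq_abs, abs_div, Real.abs_exp,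
      abs_of_pos hZ0]
    have h5 : Real.exp (f y) * Real.exp (f (u + y)) ≤
        Real.exp (-b * ‖y‖ ^ 2) * Real.exp (-(b / 2) * ‖u‖ ^ 2) := by
      rw [← Real.exp_add, ← Real.exp_add, Real.exp_le_exp]
      have h6 : ‖u‖ ≤ ‖u + y‖ + ‖y‖ := by simpa using norm_sub_le (u + y) y
      have h7 : ‖u‖ ^ 2 ≤ 2 * ‖u + y‖ ^ 2 + 2 * ‖y‖ ^ 2 := by
        nlinarith [sq_nonneg (‖u + y‖ - ‖y‖), norm_nonneg u]
      simp only [f]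
      nlinarith [sq_nonneg ‖u + y‖]
    calc Real.exp (f y) / Z * (Real.exp (f (u + y)) / Z * ‖φ u‖)
        ≤ Real.exp (f y) / Z * (Real.exp (f (u + y)) / Z * 1) := by
          gcongr; exact h.norm_le_one h0 u
      _ = Z⁻¹ ^ 2 * (Real.exp (f y) * Real.exp (f (u + y))) := by field_simp
      _ ≤ _ := by gcongr

/-- A Gaussian mollification of `φ`. -/
noncomputable def gaussianMollification (φ : E → ℂ) (ε : ℝ) (a : E) : ℂ :=
  ∫ v, φ (a + ε • v) * Real.exp (-ε * ‖a + ε • v‖ ^ 2) * Real.exp (-(1 / 4) * ‖v‖ ^ 2)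

/-- The Fourier transform `p` of `φ` damped by a Gaussian is nonnegative, by `mul_char` and
`integral_mul_exp_nonneg`. Multiplied by a second Gaussian it becomes the density of `m`, and Fubini
with the explicit Gaussian Fourier transform computes `charFun m`. -/
lemma IsPositiveDefinite.exists_charFun_eq_mul_gaussianMollification (h : IsPositiveDefinite φ)
    (h0 : φ 0 = 1) (hc : Continuous φ) {ε : ℝ} (hε : 0 < ε) :
    ∃ (m : Measure E) (K : ℂ), IsFiniteMeasure m ∧ K ≠ 0 ∧
      ∀ a, charFun m a = K * gaussianMollification φ ε a := by
  let F : E → E → ℂ := fun x u =>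
    φ u * Complex.exp (-(⟪u, x⟫ * Complex.I)) * Real.exp (-ε * ‖u‖ ^ 2)
  let p : E → ℂ := fun x => ∫ u, F x u
  have hF : Continuous (Function.uncurry F) := by
    simp only [F, Function.uncurry_def]; fun_prop
  have hFnorm (x u : E) : ‖F x u‖ ≤ Real.exp (-ε * ‖u‖ ^ 2) := by
    have : ‖Complex.exp (-(⟪u, x⟫ * Complex.I))‖ = 1 := by simp [Complex.norm_exp]
    simp only [F, norm_mul, this, Complex.norm_real, Real.norm_eq_abs, Real.abs_exp, mul_one]
    exact mul_le_of_le_one_left (Real.exp_pos _).le (h.norm_le_one h0 u)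
  have hp0 (x : E) : 0 ≤ p x := (h.mul_char x).integral_mul_exp_nonneg (by simp [h0])
    (by fun_prop) hε
  have hpre (x : E) : ((p x).re : ℂ) = p x := Complex.ext (by simp) (by
    simpa using (Complex.le_def.1 (hp0 x)).2)
  have hpm : StronglyMeasurable p := hF.stronglyMeasurable.integral_prod_right
  have hpb (x : E) : ‖p x‖ ≤ ∫ u : E, Real.exp (-ε * ‖u‖ ^ 2) :=
    norm_integral_le_of_norm_le (integrable_exp_neg_mul_norm_sq hε) (ae_of_all _ (hFnorm x))
  -- `p` is only known to be bounded; the Gaussian factor makes it integrable and removes the need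
  -- for Fourier inversion.
  let q : E → ℝ := fun x => (p x).re * Real.exp (-ε ^ 2 * ‖x‖ ^ 2)
  have hq0 (x : E) : 0 ≤ q x := mul_nonneg (Complex.le_def.1 (hp0 x)).1 (Real.exp_pos _).le
  have hqm : Measurable q := by
    have := hpm.measurable
    fun_prop
  have hq : Integrable q := by
    refine Integrable.bdd_mul (c := ∫ u : E, Real.exp (-ε * ‖u‖ ^ 2)) ?_ ?_ ?_
    · have := integrable_exp_neg_mul_norm_sq (E := E) (b := ε ^ 2) (by positivity)
      simpa using this
    · exact (Complex.measurable_re.comp hpm.measurable).aestronglyMeasurable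
    · exact ae_of_all _ fun x => (Complex.abs_re_le_norm _).trans (hpb x)
  let m : Measure E := volume.withDensity fun x => ENNReal.ofReal (q x)
  have hm : IsFiniteMeasure m := isFiniteMeasure_withDensity_ofReal hq.2
  -- The first factor comes from the Gaussian integral in `x`, the second is the Jacobian of `u = a
  -- + ε • v`.
  refine ⟨m, (Real.pi / (ε ^ 2 : ℝ)) ^ (Module.finrank ℝ E / 2 : ℂ) *
    ((|ε ^ Module.finrank ℝ E| : ℝ) : ℂ), hm, ?_, fun a => ?_⟩
  · refine mul_ne_zero ?_ ?_
    · rw [Complex.cpow_ne_zero_iff]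
      left
      have := Real.pi_ne_zero
      have := hε.ne'
      simp_all
    · have := hε.ne'
      simp [this]
  · have h1 : charFun m a = ∫ x, ∫ u, F x u * (Real.exp (-ε ^ 2 * ‖x‖ ^ 2) *
        Complex.exp (⟪x, a⟫ * Complex.I)) := by
      rw [charFun_apply, integral_withDensity_eq_integral_toReal_smul (by fun_prop)
        (ae_of_all _ fun x => ENNReal.ofReal_lt_top)]
      refine integral_congr_ae (ae_of_all _ fun x => ?_)
      simp only
      rw [integral_mul_const, ENNReal.toReal_ofReal (hq0 x), Complex.real_smul]
      simp only [q, Complex.ofReal_mul, hpre]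
      ring
    rw [h1, integral_integral_swap]
    · have h2 (u : E) : ∫ x, F x u * (Real.exp (-ε ^ 2 * ‖x‖ ^ 2) *
          Complex.exp (⟪x, a⟫ * Complex.I)) =
          (Real.pi / (ε ^ 2 : ℝ)) ^ (Module.finrank ℝ E / 2 : ℂ) *
          (φ u * Real.exp (-ε * ‖u‖ ^ 2) * Real.exp (-(1 / 4) * ‖ε⁻¹ • (u - a)‖ ^ 2)) := by
        have h3 (x : E) : F x u * (Real.exp (-ε ^ 2 * ‖x‖ ^ 2) *
            Complex.exp (⟪x, a⟫ * Complex.I)) = φ u * Real.exp (-ε * ‖u‖ ^ 2) *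
            Complex.exp (-(ε ^ 2 : ℝ) * ‖x‖ ^ 2 + Complex.I * ⟪a - u, x⟫) := by
          have : Complex.exp (-(ε ^ 2 : ℝ) * ‖x‖ ^ 2 + Complex.I * ⟪a - u, x⟫) =
              Complex.exp (-(⟪u, x⟫ * Complex.I)) * (Real.exp (-ε ^ 2 * ‖x‖ ^ 2) *
                Complex.exp (⟪x, a⟫ * Complex.I)) := by
            rw [Complex.ofReal_exp, ← Complex.exp_add, ← Complex.exp_add, inner_sub_left,
              real_inner_comm a x]
            congr 1
            push_cast
            ring
          rw [this]
          simp only [F]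
          ring
        simp_rw [h3, integral_const_mul]
        rw [GaussianFourier.integral_cexp_neg_mul_sq_norm_add (by
          rw [Complex.ofReal_re]; positivity)]
        have h4 : Complex.exp (Complex.I ^ 2 * ‖a - u‖ ^ 2 / (4 * (ε ^ 2 : ℝ))) =
            Real.exp (-(1 / 4) * ‖ε⁻¹ • (u - a)‖ ^ 2) := by
          rw [Complex.ofReal_exp]
          congr 1
          rw [norm_smul, norm_sub_rev u a, mul_pow, Complex.I_sq]
          have := hε.ne'
          simp
          field_simp
        rw [h4]
        ring
      simp_rw [h2, integral_const_mul, mul_assoc]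
      congr 1
      rw [gaussianMollification, ← integral_add_left_eq_self _ a]
      have h5 := Measure.integral_comp_smul (volume : Measure E) (fun w => φ (a + w) *
        (Real.exp (-ε * ‖a + w‖ ^ 2) * Real.exp (-(1 / 4) * ‖ε⁻¹ • w‖ ^ 2) : ℂ)) ε
      simp only [inv_smul_smul₀ hε.ne'] at h5
      simp only [add_sub_cancel_left, mul_assoc, h5, Complex.real_smul]
      rw [← mul_assoc, ← Complex.ofReal_mul, abs_inv, mul_inv_cancel₀]
      · simp
      · have := hε.ne'
        simp [this]
    · refine Integrable.mono' ((integrable_exp_neg_mul_norm_sq (E := E) (b := ε ^ 2)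
        (by positivity)).mul_prod (integrable_exp_neg_mul_norm_sq (E := E) (b := ε) hε))
        (Continuous.aestronglyMeasurable (by
          simp only [Function.uncurry_def, F]; fun_prop)) ?_
      refine ae_of_all _ fun z => ?_
      obtain ⟨x, u⟩ := z
      have : ‖Complex.exp (⟪x, a⟫ * Complex.I)‖ = 1 := by simp [Complex.norm_exp]
      simp only [Function.uncurry_apply_pair, norm_mul, this, Complex.norm_real, Real.norm_eq_abs,
        Real.abs_exp, mul_one]
      rw [mul_comm]
      gcongr
      exact hFnorm x u

lemma tendsto_gaussianMollification (hφ : ∀ a, ‖φ a‖ ≤ 1) (hc : Continuous φ) (a : E) :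
    Tendsto (fun ε => gaussianMollification φ ε a) (𝓝[>] 0)
      (𝓝 (φ a * ∫ v : E, Real.exp (-(1 / 4) * ‖v‖ ^ 2))) := by
  rw [← integral_complex_ofReal, ← integral_const_mul]
  refine tendsto_integral_filter_of_dominated_convergence
    (fun v => Real.exp (-(1 / 4) * ‖v‖ ^ 2)) ?_ ?_ (integrable_exp_neg_mul_norm_sq (by norm_num)) ?_
  · exact Eventually.of_forall fun ε => Continuous.aestronglyMeasurable (by fun_prop)
  · filter_upwards [self_mem_nhdsWithin] with ε (hε : 0 < ε)
    refine ae_of_all _ fun v => ?_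
    simp only [norm_mul, Complex.norm_real, Real.norm_eq_abs, Real.abs_exp]
    refine mul_le_of_le_one_left (Real.exp_pos _).le (mul_le_one₀ (hφ _) (Real.exp_pos _).le ?_)
    rw [Real.exp_le_one_iff]
    nlinarith [sq_nonneg ‖a + ε • v‖]
  · refine ae_of_all _ fun v => ?_
    have : Continuous fun ε : ℝ => φ (a + ε • v) * Real.exp (-ε * ‖a + ε • v‖ ^ 2) *
        (Real.exp (-(1 / 4) * ‖v‖ ^ 2) : ℂ) := by fun_prop
    refine ((this.tendsto 0).mono_left nhdsWithin_le_nhds).trans_eq ?_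
    simp

/-- **Bochner's theorem** on finite-dimensional spaces. -/
theorem IsPositiveDefinite.exists_charFun_eq_of_finiteDimensional (h : IsPositiveDefinite φ)
    (h0 : φ 0 = 1) (hc : Continuous φ) :
    ∃ μ : Measure E, IsProbabilityMeasure μ ∧ ∀ a, charFun μ a = φ a := by
  set Z := ∫ v : E, Real.exp (-(1 / 4) * ‖v‖ ^ 2) with hZ
  have hZ0 : (Z : ℂ) ≠ 0 :=
    Complex.ofReal_ne_zero.2 (integral_exp_neg_mul_norm_sq_pos (by norm_num)).ne'
  have hlim (a : E) : Tendsto (fun n : ℕ => gaussianMollification φ (1 / (n + 1)) a) atTop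
      (𝓝 (φ a * Z)) := by
    refine (tendsto_gaussianMollification (h.norm_le_one h0) hc a).comp ?_
    exact tendsto_nhdsWithin_iff.2 ⟨tendsto_one_div_add_atTop_nhds_zero_nat,
      Eventually.of_forall fun n => mem_Ioi.2 (by positivity)⟩
  have hne : ∀ᶠ n : ℕ in atTop, gaussianMollification φ (1 / (n + 1)) 0 ≠ 0 :=
    (hlim 0).eventually_ne (by simpa [h0] using hZ0)
  -- The index shift by `N` makes the total masses nonzero, so the measures can be normalised.
  obtain ⟨N, hN⟩ := eventually_atTop.1 hne
  have hex (n : ℕ) : ∃ μ : Measure E, IsProbabilityMeasure μ ∧ ∀ a, charFun μ a =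
      gaussianMollification φ (1 / ((n + N : ℕ) + 1)) a /
        gaussianMollification φ (1 / ((n + N : ℕ) + 1)) 0 := by
    have hJ := hN (n + N) (by omega)
    obtain ⟨m, K, hm, hK, hmK⟩ := h.exists_charFun_eq_mul_gaussianMollification h0 hc
      (ε := 1 / ((n + N : ℕ) + 1)) (by positivity)
    have h1 : (m.real univ : ℂ) = K * gaussianMollification φ (1 / ((n + N : ℕ) + 1)) 0 := by
      rw [← hmK, charFun_zero]
    have h2 : m ≠ 0 := by
      rintro rfl
      simp only [measureReal_zero, Pi.zero_apply, Complex.ofReal_zero] at h1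
      exact mul_ne_zero hK hJ h1.symm
    have : NeZero m := ⟨h2⟩
    refine ⟨(m univ)⁻¹ • m, inferInstance, fun a => ?_⟩
    rw [charFun_apply, integral_smul_measure, ← charFun_apply, hmK, Complex.real_smul,
      ENNReal.toReal_inv, Complex.ofReal_inv]
    rw [measureReal_def] at h1
    rw [h1]
    field_simp
  choose μ hμ hμJ using hex
  have hlim' (a : E) : Tendsto (fun n => charFun (μ n) a) atTop (𝓝 (φ a)) := by
    simp_rw [hμJ]
    have := ((hlim a).div (hlim 0) (by simpa [h0] using hZ0)).comp (tendsto_add_atTop_nat N)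
    rw [h0, one_mul, mul_div_cancel_right₀ _ hZ0] at this
    exact this
  exact exists_charFun_eq_of_isTightMeasureSet
    (isTightMeasureSet_of_tendsto_charFun hc.continuousAt hlim') hlim'

end Bochner

/-! ### Hilbert-Schmidt operators and Sazonov neighbourhoods. -/

section HilbertSchmidt

variable {H : Type*} [NormedAddCommGroup H] [InnerProductSpace ℝ H]

lemma ofReal_norm_sq_eq_tsum {ι : Type*} (e : HilbertBasis ι ℝ H) (x : H) :
    ENNReal.ofReal (‖x‖ ^ 2) = ∑' i, ENNReal.ofReal (⟪x, e i⟫ ^ 2) := by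
  have h := e.hasSum_inner_mul_inner x x
  simp_rw [real_inner_comm x, ← sq, real_inner_self_eq_norm_sq] at h
  rw [← h.tsum_eq, ENNReal.ofReal_tsum_of_nonneg (fun _ => sq_nonneg _) h.summable]

variable [CompleteSpace H]

lemma tsum_ofReal_norm_sq_apply_eq_adjoint {ι κ : Type*} (e : HilbertBasis ι ℝ H)
    (f : HilbertBasis κ ℝ H) (S : H →L[ℝ] H) :
    ∑' i, ENNReal.ofReal (‖S (e i)‖ ^ 2) = ∑' j, ENNReal.ofReal (‖S.adjoint (f j)‖ ^ 2) := by
  simp_rw [ofReal_norm_sq_eq_tsum f (S _), ofReal_norm_sq_eq_tsum e (S.adjoint _)]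
  rw [ENNReal.tsum_comm]
  refine tsum_congr fun j => tsum_congr fun i => ?_
  rw [ContinuousLinearMap.adjoint_inner_left, real_inner_comm]

/-- In either basis the sum equals that of the adjoint along `f`. This lets several Hilbert-Schmidt
operators be handled in one common basis. -/
lemma IsHilbertSchmidt.summable {S : H →L[ℝ] H} (hS : IsHilbertSchmidt S) {ι : Type*}
    (e : HilbertBasis ι ℝ H) : Summable fun i => ‖S (e i)‖ ^ 2 := by
  obtain ⟨w, f, hf⟩ := hS
  have h1 := (tsum_ofReal_norm_sq_apply_eq_adjoint e f S).trans
    (tsum_ofReal_norm_sq_apply_eq_adjoint f f S).symm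
  rw [← ENNReal.ofReal_tsum_of_nonneg (fun _ => by positivity) hf] at h1
  have h2 := ENNReal.summable_toReal (h1 ▸ ENNReal.ofReal_ne_top)
  simpa [ENNReal.toReal_ofReal, sq_nonneg] using h2

/-- Sazonov neighbourhoods of `0` contain Hilbert-Schmidt ellipsoids. -/
lemma exists_sum_norm_sq_lt_of_mem_nhds_sazonov {V : Set H}
    (hV : V ∈ @nhds H (sazonovTopology H) 0) :
    ∃ (n : ℕ) (S : Fin n → H →L[ℝ] H) (δ : ℝ), (∀ k, IsHilbertSchmidt (S k)) ∧ 0 < δ ∧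
      ∀ a, ∑ k, ‖S k a‖ ^ 2 < δ → a ∈ V := by
  rw [sazonovTopology, nhds_iInf] at hV
  refine iInf_sets_induct hV ⟨0, Fin.elim0, 1, fun k => k.elim0, one_pos, fun _ _ => mem_univ _⟩ ?_
  rintro ⟨S, hS⟩ s₁ s₂ h₁ ⟨n, R, δ, hR, hδ, h⟩
  rw [nhds_induced, map_zero, mem_comap] at h₁
  obtain ⟨t, ht, hts⟩ := h₁
  obtain ⟨ρ, hρ, hρt⟩ := Metric.mem_nhds_iff.1 ht
  refine ⟨n + 1, Fin.cons S R, min δ (ρ ^ 2), fun k => ?_, by positivity, fun a ha => ?_⟩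
  · refine Fin.cases ?_ (fun k => ?_) k
    · simpa using hS
    · simpa using hR k
  · rw [Fin.sum_univ_succ] at ha
    simp only [Fin.cons_zero, Fin.cons_succ] at ha
    have h1 : 0 ≤ ∑ k, ‖R k a‖ ^ 2 := Finset.sum_nonneg fun _ _ => by positivity
    have h2 : 0 ≤ ‖S a‖ ^ 2 := by positivity
    have h3 := lt_min_iff.1 ha
    refine ⟨hts (hρt ?_), h a (by linarith)⟩
    rw [Metric.mem_ball, dist_zero_right]
    exact lt_of_pow_lt_pow_left₀ 2 hρ.le (by linarith)

/-- A bounded function that is Sazonov continuous at `0` is controlled by Hilbert-Schmidt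
quadratic forms. -/
lemma exists_norm_one_sub_le_of_sazonov {φ : H → ℂ} (hφ : ∀ a, ‖φ a‖ ≤ 1)
    (hs : ∀ ε > 0, ∀ᶠ a in @nhds H (sazonovTopology H) 0, ‖1 - φ a‖ ≤ ε) {ε : ℝ} (hε : 0 < ε) :
    ∃ (n : ℕ) (S : Fin n → H →L[ℝ] H), (∀ k, IsHilbertSchmidt (S k)) ∧ ∃ C : ℝ, 0 ≤ C ∧
      ∀ a, ‖1 - φ a‖ ≤ ε + C * ∑ k, ‖S k a‖ ^ 2 := by
  obtain ⟨n, S, δ, hS, hδ, h⟩ := exists_sum_norm_sq_lt_of_mem_nhds_sazonov (hs ε hε)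
  -- Outside the ellipsoid the trivial bound `‖1 - φ a‖ ≤ 2` is at most `2 / δ` times the quadratic
  -- form.
  refine ⟨n, S, hS, 2 / δ, by positivity, fun a => ?_⟩
  have h1 : 0 ≤ ∑ k, ‖S k a‖ ^ 2 := Finset.sum_nonneg fun _ _ => by positivity
  rcases lt_or_ge (∑ k, ‖S k a‖ ^ 2) δ with hlt | hge
  · have : ‖1 - φ a‖ ≤ ε := h a hlt
    have : 0 ≤ 2 / δ * ∑ k, ‖S k a‖ ^ 2 := by positivity
    linarith
  · have h2 : ‖1 - φ a‖ ≤ 2 := by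
      calc ‖1 - φ a‖ ≤ ‖(1 : ℂ)‖ + ‖φ a‖ := norm_sub_le _ _
        _ ≤ 2 := by rw [norm_one]; linarith [hφ a]
    have h3 : 2 ≤ 2 / δ * ∑ k, ‖S k a‖ ^ 2 := by
      rw [div_mul_eq_mul_div, le_div_iff₀ hδ]
      linarith
    linarith

end HilbertSchmidt

/-! ### Gaussian averaging and tail estimates. -/

section Gaussian

variable {H : Type*} [NormedAddCommGroup H] [InnerProductSpace ℝ H] {κ : Type*} [Fintype κ]

lemma memLp_eval_stdGaussian (i : κ) :
    MemLp (fun g : EuclideanSpace ℝ κ => g i) 2 (stdGaussian (EuclideanSpace ℝ κ)) := by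
  have h := (EuclideanSpace.proj i : EuclideanSpace ℝ κ →L[ℝ] ℝ).comp_memLp'
    (IsGaussian.memLp_two_id (μ := stdGaussian (EuclideanSpace ℝ κ)))
  exact h

lemma integral_eval_mul_eval_stdGaussian [DecidableEq κ] (i j : κ) :
    ∫ g : EuclideanSpace ℝ κ, g i * g j ∂(stdGaussian (EuclideanSpace ℝ κ)) =
      if i = j then 1 else 0 := by
  have h1 := covariance_eval_multivariateGaussian (μ := (0 : EuclideanSpace ℝ κ))
    (S := (1 : Matrix κ κ ℝ)) Matrix.PosSemidef.one i j
  rw [multivariateGaussian_zero_one,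
    covariance_eq_sub (memLp_eval_stdGaussian i) (memLp_eval_stdGaussian j)] at h1
  have h2 (k : κ) : ∫ g : EuclideanSpace ℝ κ, g k ∂(stdGaussian (EuclideanSpace ℝ κ)) = 0 :=
    integral_strongDual_stdGaussian (EuclideanSpace.proj k : EuclideanSpace ℝ κ →L[ℝ] ℝ)
  simpa [h2, Matrix.one_apply] using h1

lemma integrable_norm_sq_sum_smul_stdGaussian (v : κ → H) :
    Integrable (fun g : EuclideanSpace ℝ κ => ‖∑ i, g i • v i‖ ^ 2)
      (stdGaussian (EuclideanSpace ℝ κ)) := by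
  have h : MemLp (fun g : EuclideanSpace ℝ κ => ∑ i, g i • v i) 2
      (stdGaussian (EuclideanSpace ℝ κ)) :=
    memLp_finsetSum _ fun i _ =>
      ((ContinuousLinearMap.toSpanSingleton ℝ (v i)).comp_memLp' (memLp_eval_stdGaussian i))
  exact h.integrable_norm_pow (by norm_num)

lemma integral_norm_sq_sum_smul_stdGaussian (v : κ → H) :
    ∫ g : EuclideanSpace ℝ κ, ‖∑ i, g i • v i‖ ^ 2 ∂(stdGaussian (EuclideanSpace ℝ κ)) =
      ∑ i, ‖v i‖ ^ 2 := by
  classical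
  have h (g : EuclideanSpace ℝ κ) :
      ‖∑ i, g i • v i‖ ^ 2 = ∑ i, ∑ j, g i * g j * ⟪v i, v j⟫ := by
    rw [← real_inner_self_eq_norm_sq, sum_inner]
    refine Finset.sum_congr rfl fun i _ => ?_
    rw [inner_sum]
    refine Finset.sum_congr rfl fun j _ => ?_
    rw [real_inner_smul_left, real_inner_smul_right]
    ring
  have hint (i j : κ) : Integrable (fun g : EuclideanSpace ℝ κ => g i * g j * ⟪v i, v j⟫)
      (stdGaussian (EuclideanSpace ℝ κ)) :=
    ((memLp_eval_stdGaussian i).integrable_mul (memLp_eval_stdGaussian j)).mul_const _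
  simp_rw [h]
  rw [integral_finsetSum _ fun i _ => integrable_finsetSum _ fun j _ => hint i j]
  simp_rw [integral_finsetSum _ fun j _ => hint _ j, integral_mul_const,
    integral_eval_mul_eval_stdGaussian]
  simp

variable [SecondCountableTopology H] [MeasurableSpace H] [BorelSpace H]

/-- Averaging a characteristic function over Gaussian coefficients. -/
lemma integral_charFun_sum_smul_stdGaussian (μ : Measure H) [IsProbabilityMeasure μ] (v : κ → H)
    (s : ℝ) :
    ∫ g : EuclideanSpace ℝ κ, charFun μ (s • ∑ i, g i • v i) ∂(stdGaussian (EuclideanSpace ℝ κ)) =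
      ∫ x, Real.exp (-(s ^ 2 / 2) * ∑ i, ⟪v i, x⟫ ^ 2) ∂μ := by
  simp_rw [charFun_apply]
  rw [integral_integral_swap]
  · rw [← integral_complex_ofReal]
    refine integral_congr_ae (ae_of_all _ fun x => ?_)
    -- For fixed `x`, the integral over `g` is the standard Gaussian characteristic function at the
    -- vector of the `s⟪v i, x⟫`.
    have h1 := charFun_stdGaussian (s • (WithLp.toLp 2 fun i => ⟪v i, x⟫ : EuclideanSpace ℝ κ))
    simp only
    rw [charFun_apply] at h1
    convert! h1 using 1
    · refine integral_congr_ae (ae_of_all _ fun g => ?_)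
      simp only [inner_smul_right, inner_sum, PiLp.inner_apply]
      simp [real_inner_comm, mul_comm]
    · rw [Complex.ofReal_exp]
      congr 1
      rw [norm_smul, ← Complex.ofReal_pow, mul_pow, EuclideanSpace.real_norm_sq_eq]
      simp
      ring
  · refine Integrable.of_bound (Continuous.aestronglyMeasurable ?_) 1 (ae_of_all _ fun p => ?_)
    · simp only [Function.uncurry_def]
      fun_prop
    · simp [Function.uncurry_def, Complex.norm_exp]

/-- A tail estimate in terms of the characteristic function. -/
lemma measureReal_lt_sum_inner_sq_le {n : ℕ} (μ : Measure H) [IsProbabilityMeasure μ] (v : κ → H)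
    (S : Fin n → H →L[ℝ] H) {ε C r : ℝ} (hr : 0 < r)
    (h : ∀ g : κ → ℝ, ‖1 - charFun μ (∑ i, g i • v i)‖ ≤ ε + C * ∑ k, ‖S k (∑ i, g i • v i)‖ ^ 2) :
    μ.real {x | r ^ 2 < ∑ i, ⟪v i, x⟫ ^ 2} ≤
      3 * (ε + C * (r⁻¹ ^ 2 * ∑ i, ∑ k, ‖S k (v i)‖ ^ 2)) := by
  let γ := stdGaussian (EuclideanSpace ℝ κ)
  let f : H → ℝ := fun x => 1 - Real.exp (-(r⁻¹ ^ 2 / 2) * ∑ i, ⟪v i, x⟫ ^ 2)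
  have hexp (x : H) : Real.exp (-(r⁻¹ ^ 2 / 2) * ∑ i, ⟪v i, x⟫ ^ 2) ≤ 1 := by
    rw [Real.exp_le_one_iff, neg_mul, neg_nonpos]
    exact mul_nonneg (by positivity) (Finset.sum_nonneg fun _ _ => sq_nonneg _)
  have hintexp : Integrable (fun x => Real.exp (-(r⁻¹ ^ 2 / 2) * ∑ i, ⟪v i, x⟫ ^ 2)) μ := by
    refine Integrable.of_bound (Continuous.aestronglyMeasurable (by fun_prop)) 1
      (ae_of_all _ fun x => ?_)
    simpa using hexp x
  have hf0 (x : H) : 0 ≤ f x := sub_nonneg.2 (hexp x)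
  have hf : Integrable f μ := (integrable_const 1).sub hintexp
  have hcf : Integrable (fun g : EuclideanSpace ℝ κ => charFun μ (r⁻¹ • ∑ i, g i • v i)) γ := by
    refine Integrable.of_bound ?_ 1 (ae_of_all _ fun g => norm_charFun_le_one _)
    refine (measurable_charFun.comp (Continuous.measurable ?_)).aestronglyMeasurable
    fun_prop
  have h1 : ∫ x, f x ∂μ ≤ ε + C * (r⁻¹ ^ 2 * ∑ i, ∑ k, ‖S k (v i)‖ ^ 2) := by
    have h2 : ((∫ x, f x ∂μ : ℝ) : ℂ) =
        ∫ g : EuclideanSpace ℝ κ, (1 - charFun μ (r⁻¹ • ∑ i, g i • v i)) ∂γ := by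
      rw [integral_sub (integrable_const _) hcf, integral_charFun_sum_smul_stdGaussian,
        integral_sub (integrable_const _) hintexp]
      simp
    have hint (k : Fin n) := integrable_norm_sq_sum_smul_stdGaussian (κ := κ) fun i => S k (v i)
    have h3 : ∫ x, f x ∂μ ≤ ∫ g : EuclideanSpace ℝ κ,
        (ε + C * ∑ k, r⁻¹ ^ 2 * ‖∑ i, g i • S k (v i)‖ ^ 2) ∂γ := by
      calc ∫ x, f x ∂μ ≤ ‖((∫ x, f x ∂μ : ℝ) : ℂ)‖ := by
            rw [Complex.norm_real]; exact le_abs_self _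
        _ ≤ _ := by
            rw [h2]
            refine norm_integral_le_of_norm_le ?_ (ae_of_all _ fun g => ?_)
            · exact (integrable_const _).add
                ((integrable_finsetSum _ fun k _ => (hint k).const_mul _).const_mul _)
            · have h4 := h fun i => r⁻¹ * g i
              have h5 : ∑ i, (r⁻¹ * g i) • v i = r⁻¹ • ∑ i, g i • v i := by
                simp [Finset.smul_sum, smul_smul]
              rw [h5] at h4
              refine h4.trans_eq ?_
              congr 2
              refine Finset.sum_congr rfl fun k _ => ?_
              rw [map_smul, norm_smul, mul_pow, map_sum]
              simp
    refine h3.trans_eq ?_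
    rw [integral_add (integrable_const _)
      ((integrable_finsetSum _ fun k _ => (hint k).const_mul _).const_mul _), integral_const_mul,
      integral_finsetSum _ fun k _ => (hint k).const_mul _]
    simp_rw [integral_const_mul, integral_norm_sq_sum_smul_stdGaussian]
    rw [← Finset.mul_sum, Finset.sum_comm]
    simp
  -- Markov's inequality: on the tail event `f ≥ 1 - exp(-1/2) ≥ 1/3`, whence the constant `3`.
  have h2 : (1 / 3) * μ.real {x | (1 / 3 : ℝ) ≤ f x} ≤ ∫ x, f x ∂μ :=
    mul_meas_ge_le_integral_of_nonneg (ae_of_all _ hf0) hf _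
  have h3 : μ.real {x | r ^ 2 < ∑ i, ⟪v i, x⟫ ^ 2} ≤ μ.real {x | (1 / 3 : ℝ) ≤ f x} := by
    refine measureReal_mono fun x hx => ?_
    have hx' : r ^ 2 < ∑ i, ⟪v i, x⟫ ^ 2 := hx
    have h4 : Real.exp (-(r⁻¹ ^ 2 / 2) * ∑ i, ⟪v i, x⟫ ^ 2) ≤ Real.exp (-(1 / 2)) := by
      rw [Real.exp_le_exp, neg_mul, neg_le_neg_iff]
      have : r⁻¹ ^ 2 / 2 * r ^ 2 = 1 / 2 := by field_simp
      rw [← this]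
      gcongr
    have h5 : Real.exp (-(1 / 2)) ≤ 2 / 3 := by
      rw [Real.exp_neg, inv_le_comm₀ (Real.exp_pos _) (by norm_num)]
      have := Real.add_one_le_exp (1 / 2 : ℝ)
      norm_num at this ⊢
      linarith
    show (1 / 3 : ℝ) ≤ 1 - _
    linarith
  linarith

end Gaussian

/-! ### Tightness in Hilbert space and the Minlos-Sazonov theorem. -/

section MinlosSazonov

variable {H : Type*} [NormedAddCommGroup H] [InnerProductSpace ℝ H] {ι : Type*}

/-- The partial sums `∑ i ∈ F, ⟪e i, x⟫ • e i` of the Fourier expansion of `x`. -/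
noncomputable def partialExpansion (e : HilbertBasis ι ℝ H) (F : Finset ι) (x : H) : H :=
  ∑ i ∈ F, ⟪e i, x⟫ • e i

lemma continuous_partialExpansion (e : HilbertBasis ι ℝ H) (F : Finset ι) :
    Continuous (partialExpansion e F) := by
  unfold partialExpansion
  fun_prop

lemma tendsto_partialExpansion (e : HilbertBasis ι ℝ H) (x : H) :
    Tendsto (fun F => partialExpansion e F x) atTop (𝓝 x) := by
  have := e.hasSum_repr x
  simp_rw [e.repr_apply_apply] at this
  exact this

lemma inner_partialExpansion [DecidableEq ι] (e : HilbertBasis ι ℝ H) (F : Finset ι) (x : H)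
    (i : ι) : ⟪e i, partialExpansion e F x⟫ = if i ∈ F then ⟪e i, x⟫ else 0 := by
  have h := orthonormal_iff_ite.1 e.orthonormal
  simp only [partialExpansion, inner_sum, inner_smul_right, h]
  simp

lemma norm_sub_partialExpansion_sq [DecidableEq ι] (e : HilbertBasis ι ℝ H) (F N : Finset ι) {x : H}
    (hx : partialExpansion e F x = x) :
    ‖x - partialExpansion e N x‖ ^ 2 = ∑ i : ↥(F \ N), ⟪e i, x⟫ ^ 2 := by
  have h1 : x - partialExpansion e N x = ∑ i ∈ F \ N, ⟪e i, x⟫ • e i := by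
    have h2 : partialExpansion e N x = ∑ i ∈ F ∩ N, ⟪e i, x⟫ • e i := by
      rw [Finset.inter_comm, ← Finset.filter_mem_eq_inter, Finset.sum_filter, partialExpansion]
      refine Finset.sum_congr rfl fun i _ => ?_
      have := inner_partialExpansion e F x i
      rw [hx] at this
      rw [this]
      split_ifs <;> simp
    rw [h2, sub_eq_iff_eq_add]
    nth_rw 1 [← hx]
    rw [partialExpansion, ← Finset.sum_inter_add_sum_sdiff F N, add_comm]
  rw [h1, ← real_inner_self_eq_norm_sq, e.orthonormal.inner_sum,
    ← Finset.sum_coe_sort (F \ N)]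
  simp [sq]

/-- A criterion for tightness in Hilbert spaces. -/
lemma isTightMeasureSet_of_partialExpansion [CompleteSpace H] [MeasurableSpace H]
    (e : HilbertBasis ι ℝ H) {A : Set (Measure H)}
    (hbdd : ∀ η : ENNReal, 0 < η → ∃ R : ℝ, ∀ μ ∈ A, μ {x | R < ‖x‖} ≤ η)
    (htail : ∀ η : ENNReal, 0 < η → ∀ r : ℝ, 0 < r → ∃ N : Finset ι, ∀ μ ∈ A,
      μ {x | r < ‖x - partialExpansion e N x‖} ≤ η) :
    IsTightMeasureSet A := by
  rw [isTightMeasureSet_iff_exists_isCompact_measure_compl_le]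
  intro η hη
  have hη2 : 0 < η / 2 := ENNReal.half_pos hη.ne'
  obtain ⟨R, hR⟩ := hbdd (η / 2) hη2
  obtain ⟨δ, hδ, hδη⟩ := ENNReal.exists_pos_sum_of_countable' hη2.ne' ℕ
  choose N hN using fun k : ℕ => htail (δ k) (hδ k) (1 / (k + 1)) (by positivity)
  let K : Set H := {x | ‖x‖ ≤ R} ∩ ⋂ k : ℕ, {x | ‖x - partialExpansion e (N k) x‖ ≤ 1 / (k + 1)}
  refine ⟨K, ?_, fun μ hμ => ?_⟩
  · refine TotallyBounded.isCompact_of_isClosed ?_ ?_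
    · rw [Metric.totallyBounded_iff]
      intro ρ hρ
      obtain ⟨k, hk⟩ := exists_nat_one_div_lt (half_pos hρ)
      -- Points of `K` are within `ρ / 2` of the image under `L` of a finite-dimensional ball, which
      -- is compact and so has a finite `ρ / 2`-net.
      let L : (N k → ℝ) → H := fun c => ∑ i, c i • e i
      have hT : IsCompact (L '' Metric.closedBall 0 R) :=
        (isCompact_closedBall 0 R).image (by fun_prop)
      obtain ⟨t, ht, hcover⟩ := Metric.totallyBounded_iff.1 hT.totallyBounded (ρ / 2) (half_pos hρ)
      refine ⟨t, ht, fun x hx => ?_⟩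
      have hxR : ‖x‖ ≤ R := hx.1
      have hxk : ‖x - partialExpansion e (N k) x‖ ≤ 1 / (k + 1) := mem_iInter.1 hx.2 k
      have hmem : partialExpansion e (N k) x ∈ L '' Metric.closedBall 0 R := by
        refine ⟨fun i => ⟪e i, x⟫, ?_, ?_⟩
        · rw [mem_closedBall_zero_iff, pi_norm_le_iff_of_nonneg ((norm_nonneg x).trans hxR)]
          intro i
          have := norm_inner_le_norm (𝕜 := ℝ) (e i) x
          rw [e.orthonormal.1 i, one_mul] at this
          exact this.trans hxR
        · simp only [L, partialExpansion]
          exact Finset.sum_coe_sort (N k) fun i => ⟪e i, x⟫ • e i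
      obtain ⟨y, hy, hxy⟩ := mem_iUnion₂.1 (hcover hmem)
      refine mem_iUnion₂.2 ⟨y, hy, ?_⟩
      rw [Metric.mem_ball] at hxy ⊢
      have h1 : dist x (partialExpansion e (N k) x) < ρ / 2 := by
        rw [dist_eq_norm]; exact hxk.trans_lt hk
      linarith [dist_triangle x (partialExpansion e (N k) x) y]
    · refine (isClosed_le continuous_norm continuous_const).inter (isClosed_iInter fun k => ?_)
      have := continuous_partialExpansion e (N k)
      exact isClosed_le (by fun_prop) continuous_const
  · have hsub : Kᶜ ⊆ {x | R < ‖x‖} ∪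
        ⋃ k : ℕ, {x | 1 / ((k : ℝ) + 1) < ‖x - partialExpansion e (N k) x‖} := by
      intro x hx
      by_contra hcon
      simp only [mem_union, mem_iUnion, mem_ofPred_eq, not_or, not_exists, not_lt] at hcon
      exact hx ⟨hcon.1, mem_iInter.2 hcon.2⟩
    calc μ Kᶜ ≤ μ {x | R < ‖x‖} +
          ∑' k : ℕ, μ {x | 1 / ((k : ℝ) + 1) < ‖x - partialExpansion e (N k) x‖} :=
          (measure_mono hsub).trans ((measure_union_le _ _).trans
            (add_le_add le_rfl (measure_iUnion_le _)))
      _ ≤ η / 2 + ∑' k, δ k := add_le_add (hR μ hμ) (ENNReal.tsum_le_tsum fun k => hN k μ hμ)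
      _ ≤ η / 2 + η / 2 := by gcongr
      _ = η := ENNReal.add_halves η

variable [MeasurableSpace H] [BorelSpace H] {φ : H → ℂ}

/-- Finite-dimensional approximations of the measure with characteristic function `φ`. -/
lemma IsPositiveDefinite.exists_charFun_eq_comp_partialExpansion (h : IsPositiveDefinite φ)
    (h0 : φ 0 = 1) (hc : Continuous φ) (e : HilbertBasis ι ℝ H) (F : Finset ι) :
    ∃ μ : Measure H, IsProbabilityMeasure μ ∧
      (∀ a, charFun μ a = φ (partialExpansion e F a)) ∧ ∀ᵐ x ∂μ, partialExpansion e F x = x := by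
  classical
  -- The measure is the image under `L` of the Bochner measure of `φ ∘ L`.
  let L : EuclideanSpace ℝ F →L[ℝ] H :=
    ∑ i : F, (EuclideanSpace.proj i : EuclideanSpace ℝ F →L[ℝ] ℝ).smulRight (e i)
  have hL (g : EuclideanSpace ℝ F) : L g = ∑ i, g i • e i := by simp [L]
  obtain ⟨ρ, hρ, hρφ⟩ := (h.comp_addMonoidHom
    (L.toLinearMap.toAddMonoidHom)).exists_charFun_eq_of_finiteDimensional (by simp [h0])
    (hc.comp L.continuous)
  refine ⟨ρ.map L, Measure.isProbabilityMeasure_map (by fun_prop), fun a => ?_, ?_⟩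
  · have h1 := hρφ (WithLp.toLp 2 fun i : F => ⟪e i, a⟫)
    have h2 : partialExpansion e F a = L (WithLp.toLp 2 fun i : F => ⟪e i, a⟫) := by
      rw [hL, partialExpansion]
      exact (Finset.sum_coe_sort F fun i => ⟪e i, a⟫ • e i).symm
    rw [h2]
    refine Eq.trans ?_ h1
    rw [charFun_apply, charFun_apply, integral_map (by fun_prop)
      (Continuous.aestronglyMeasurable (by fun_prop))]
    refine integral_congr_ae (ae_of_all _ fun g => ?_)
    simp only [hL, sum_inner, real_inner_smul_left, PiLp.inner_apply]
    simp [mul_comm]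
  · rw [ae_map_iff L.continuous.aemeasurable
      (isClosed_eq (continuous_partialExpansion e F) continuous_id').measurableSet]
    refine ae_of_all _ fun g => ?_
    have hon := orthonormal_iff_ite.1 e.orthonormal
    have h3 (i : F) : ⟪e i, L g⟫ = g i := by
      rw [hL, inner_sum]
      simp [inner_smul_right, hon]
    rw [partialExpansion, ← Finset.sum_coe_sort F, hL]
    rw [hL] at h3
    exact Finset.sum_congr rfl fun i _ => by rw [h3]

variable [CompleteSpace H] [SecondCountableTopology H]

/-- The **Minlos-Sazonov theorem**: a positive definite function that is Sazonov continuous at `0`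
is the characteristic function of a probability measure. -/
theorem IsPositiveDefinite.exists_charFun_eq (h : IsPositiveDefinite φ) (h0 : φ 0 = 1)
    (hs : ∀ ε > 0, ∀ᶠ a in @nhds H (sazonovTopology H) 0, ‖1 - φ a‖ ≤ ε) :
    ∃ μ : Measure H, IsProbabilityMeasure μ ∧ ∀ a, charFun μ a = φ a := by
  classical
  have hbound {ε : ℝ} (hε : 0 < ε) :=
    exists_norm_one_sub_le_of_sazonov (h.norm_le_one h0) hs hε
  have hc : Continuous φ := by
    refine h.continuous h0 ?_
    rw [Metric.continuousAt_iff']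
    intro ε hε
    obtain ⟨n, S, -, C, -, hC⟩ := hbound (half_pos hε)
    have h1 : Continuous fun a => ε / 2 + C * ∑ k, ‖S k a‖ ^ 2 := by fun_prop
    have h2 := (h1.tendsto 0).eventually_lt_const (u := ε) (by simp [hε])
    filter_upwards [h2] with a ha
    rw [h0, dist_comm, dist_eq_norm]
    exact (hC a).trans_lt ha
  obtain ⟨w, e, -⟩ := exists_hilbertBasis ℝ H
  choose μ hμ hμφ hμe using fun F : Finset w =>
    h.exists_charFun_eq_comp_partialExpansion h0 hc e F
  -- The summable `q` does not depend on `F`: this uniformity is what tightness needs. It comes from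
  -- the Hilbert-Schmidt sums in the basis `e`.
  have htail {ε : ℝ} (hε : 0 < ε) : ∃ q : w → ℝ, (∀ i, 0 ≤ q i) ∧ Summable q ∧
      ∀ (F N : Finset w) (r : ℝ), 0 < r →
        (μ F).real {x | r < ‖x - partialExpansion e N x‖} ≤
          3 * (ε + r⁻¹ ^ 2 * ∑ i ∈ F \ N, q i) := by
    obtain ⟨n, S, hS, C, hC0, hC⟩ := hbound hε
    refine ⟨fun i => C * ∑ k, ‖S k (e i)‖ ^ 2, fun i => by positivity,
      (summable_sum fun k _ => (hS k).summable e).mul_left C, fun F N r hr => ?_⟩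
    have h1 := measureReal_lt_sum_inner_sq_le (μ F) (fun i : ↥(F \ N) => e i) S
      (ε := ε) hr fun g => by
        have h2 : partialExpansion e F (∑ i : ↥(F \ N), g i • e i) =
            ∑ i : ↥(F \ N), g i • e i := by
          have h3 : ∀ i : ↥(F \ N), partialExpansion e F (e i) = e i := by
            intro i
            have hon := orthonormal_iff_ite.1 e.orthonormal
            have hi := (Finset.mem_sdiff.1 i.2).1
            simp [partialExpansion, hon, hi]
          simp only [partialExpansion, inner_sum, Finset.sum_smul] at h3 ⊢
          rw [Finset.sum_comm]
          refine Finset.sum_congr rfl fun i _ => ?_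
          nth_rw 2 [← h3 i]
          simp [Finset.smul_sum, inner_smul_right, mul_smul]
        rw [hμφ, h2]
        exact hC _
    calc (μ F).real {x | r < ‖x - partialExpansion e N x‖}
        ≤ (μ F).real {x | r ^ 2 < ∑ i : ↥(F \ N), ⟪e i, x⟫ ^ 2} := by
          refine ENNReal.toReal_mono (measure_ne_top _ _) (measure_mono_ae ?_)
          filter_upwards [hμe F] with x hx hxr
          have hxr' : r < ‖x - partialExpansion e N x‖ := hxr
          show r ^ 2 < _
          rw [← norm_sub_partialExpansion_sq e F N hx]
          gcongr
      _ ≤ _ := h1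
      _ = _ := by
          rw [Finset.sum_coe_sort (F \ N) fun i => ∑ k, ‖S k (e i)‖ ^ 2, ← Finset.mul_sum]
          ring
  have htight : IsTightMeasureSet (range μ) := by
    have hpos {η : ENNReal} (hη : 0 < η) : ∃ ε : ℝ, 0 < ε ∧ ENNReal.ofReal (6 * ε) ≤ η := by
      obtain ⟨ε, -, hε, hεη⟩ := ENNReal.lt_iff_exists_real_btwn.1 hη
      refine ⟨ε / 6, by linarith [ENNReal.ofReal_pos.1 hε], ?_⟩
      rw [mul_div_cancel₀ _ (by norm_num)]
      exact hεη.le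
    have hle {F : Finset w} {s : Set H} {η : ENNReal} {ε : ℝ}
        (h1 : ENNReal.ofReal (6 * ε) ≤ η) (h2 : (μ F).real s ≤ 6 * ε) : μ F s ≤ η := by
      rw [← ofReal_measureReal]
      exact (ENNReal.ofReal_le_ofReal h2).trans h1
    refine isTightMeasureSet_of_partialExpansion e (fun η hη => ?_) (fun η hη r hr => ?_)
    · obtain ⟨ε, hε, hεη⟩ := hpos hη
      obtain ⟨q, hq0, hq, hq'⟩ := htail hε
      have hlim : Tendsto (fun R : ℝ => R⁻¹ ^ 2 * ∑' i, q i) atTop (𝓝 0) := by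
        have := (tendsto_inv_atTop_zero (𝕜 := ℝ)).pow 2 |>.mul_const (∑' i, q i)
        simpa using this
      obtain ⟨R, hR, hR0⟩ := ((hlim.eventually_lt_const hε).and (eventually_gt_atTop 0)).exists
      refine ⟨R, ?_⟩
      rintro _ ⟨F, rfl⟩
      refine hle hεη ?_
      -- With `N = ∅` the expansion vanishes, so the tail bound becomes a bound on `‖x‖`.
      have h1 := hq' F ∅ R hR0
      simp only [partialExpansion, Finset.sum_empty, sub_zero, Finset.sdiff_empty] at h1
      have h2 : R⁻¹ ^ 2 * ∑ i ∈ F, q i ≤ R⁻¹ ^ 2 * ∑' i, q i := by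
        gcongr
        exact hq.sum_le_tsum _ fun i _ => hq0 i
      linarith
    · obtain ⟨ε, hε, hεη⟩ := hpos hη
      obtain ⟨q, hq0, hq, hq'⟩ := htail hε
      obtain ⟨N, hN⟩ := summable_iff_vanishing_norm.1 hq (r ^ 2 * ε) (by positivity)
      refine ⟨N, ?_⟩
      rintro _ ⟨F, rfl⟩
      refine hle hεη ?_
      have h1 := hq' F N r hr
      have h2 := (le_abs_self _).trans_lt (hN (F \ N) Finset.sdiff_disjoint)
      have h3 : r⁻¹ ^ 2 * ∑ i ∈ F \ N, q i ≤ r⁻¹ ^ 2 * (r ^ 2 * ε) := by gcongr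
      have h4 : r⁻¹ ^ 2 * (r ^ 2 * ε) = ε := by field_simp
      linarith
  refine exists_charFun_eq_of_isTightMeasureSet (l := atTop) htight fun a => ?_
  simp_rw [hμφ]
  exact (hc.tendsto a).comp (tendsto_partialExpansion e a)

end MinlosSazonov

/-! ### Real negative definite symbols and their integrals. -/

section Symbol

variable {H : Type*} [NormedAddCommGroup H]

/-- The points `a, 0` with weights `1, -1` give `-ψ a - ψ (-a) ≤ 0`, and `ψ (-a) = ψ a` for real
`ψ`. -/
lemma IsNegativeDefinite.nonneg {ψ : H → ℂ} (h : IsNegativeDefinite ψ) (h0 : ψ 0 = 0)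
    (hreal : ∀ a, ψ a = conj (ψ a)) (a : H) : 0 ≤ ψ a := by
  have h1 := h.sum_nonpos 2 ![a, 0] ![1, -1] (by simp)
  simp [Fin.sum_univ_two, h0, h.hermitian, ← hreal] at h1
  have h2 := Complex.le_def.1 h1
  have h3 : (ψ a).im = 0 := Complex.conj_eq_iff_im.1 (hreal a).symm
  simp at h2
  exact Complex.le_def.2 ⟨by simp; linarith, by simp [h3]⟩

variable [InnerProductSpace ℝ H]

/-- Integrals of negative definite functions are negative definite. -/
lemma IsNegativeDefinite.integral {ψ : H → ℂ} (h : IsNegativeDefinite ψ) {Ω : Type*}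
    [MeasurableSpace Ω] {m : Measure Ω} (B : Ω → H →L[ℝ] H)
    (hint : ∀ a, Integrable (fun r => ψ (B r a)) m) :
    IsNegativeDefinite fun a => ∫ r, ψ (B r a) ∂m where
  zero_nonneg := integral_nonneg fun r => by simpa using h.zero_nonneg
  hermitian a := by simp only [map_neg, h.hermitian, integral_conj]
  sum_nonpos n a c hc := by
    have hi (i j : Fin n) :
        Integrable (fun r => ψ (B r (a i - a j)) * c i * conj (c j)) m :=
      ((hint _).mul_const _).mul_const _
    simp_rw [← integral_mul_const]
    simp_rw [← integral_finsetSum _ fun j _ => hi _ j]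
    rw [← integral_finsetSum _ fun i _ => integrable_finsetSum _ fun j _ => hi i j]
    refine integral_nonpos fun r => ?_
    simpa using h.sum_nonpos n (fun i => B r (a i)) c hc

end Symbol

/-! ### Flow property, periodicity and limit of the exponentials. -/

section SymbolExp

variable {H : Type*} [NormedAddCommGroup H] [InnerProductSpace ℝ H] [CompleteSpace H]
  {U : ℝ → ℝ → H →L[ℝ] H} {σ : ℝ → H →L[ℝ] H} {lam : H → ℂ}

lemma integrand_nonneg (H3 : IsLevySymbol lam) (H5 : ∀ a, lam a = conj (lam a)) (t : ℝ) (a : H)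
    (r : ℝ) : 0 ≤ integrand U σ lam t a r :=
  H3.negativeDefinite.nonneg H3.zero H5 _

lemma integrand_adjoint (H1 : IsEvolutionFamily U) {r s t : ℝ} (hrs : r ≤ s) (hst : s ≤ t)
    (a : H) : integrand U σ lam s ((U s t).adjoint a) r = integrand U σ lam t a r := by
  rw [integrand, integrand, ← H1.comp r s t hrs hst, ContinuousLinearMap.adjoint_comp]
  rfl

/-- Fourier form of `μ_{-∞,t} = (μ_{-∞,s} ∘ U_{s,t}⁻¹) ∗ μ_{s,t}`: the integral splits at `s`, and
the evolution law rewrites the part before `s`. -/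
lemma symbolExpInf_eq_mul (H1 : IsEvolutionFamily U)
    (hint : ∀ t a, IntegrableOn (integrand U σ lam t a) (Iio t)) {s t : ℝ}
    (hst : s ≤ t) (a : H) : symbolExpInf U σ lam t a =
      symbolExpInf U σ lam s ((U s t).adjoint a) * symbolExp U σ lam s t a := by
  have hint : IntegrableOn (integrand U σ lam t a) (Iic t) :=
    (integrableOn_Iic_iff_integrableOn_Iio (by simp)).2 (hint t a)
  rw [symbolExpInf, symbolExpInf, symbolExp, ← Complex.exp_add, ← neg_add,
    intervalIntegral.integral_of_le hst, ← integral_Iic_eq_integral_Iio,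
    ← integral_Iic_eq_integral_Iio, ← Iic_union_Ioc_eq_Iic hst,
    setIntegral_union (Iic_disjoint_Ioc le_rfl) measurableSet_Ioc
      (hint.mono_set (Iic_subset_Iic.2 hst)) (hint.mono_set Ioc_subset_Iic_self)]
  congr 3
  exact setIntegral_congr_fun measurableSet_Iic fun r hr => (integrand_adjoint H1 hr hst a).symm

lemma symbolExpInf_add_period {T : ℝ} (hUT : PeriodicEvolution U T) (hσT : Function.Periodic σ T)
    (t : ℝ) : symbolExpInf U σ lam (t + T) = symbolExpInf U σ lam t := by
  ext a
  have h1 := (measurePreserving_add_right (volume : Measure ℝ) T).setIntegral_preimage_emb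
    (measurableEmbedding_addRight T) (integrand U σ lam (t + T) a) (Iio (t + T))
  rw [symbolExpInf, symbolExpInf, ← h1]
  congr 2
  have : (fun x => x + T) ⁻¹' Iio (t + T) = Iio t := by ext; simp
  rw [this]
  refine setIntegral_congr_fun measurableSet_Iio fun r hr => ?_
  simp only [integrand]
  rw [hσT r, hUT r t (le_of_lt hr)]

lemma tendsto_symbolExp_sub_nat_mul
    (hint : ∀ t a, IntegrableOn (integrand U σ lam t a) (Iio t)) {T : ℝ} (hT : 0 < T) (t : ℝ)
    (a : H) : Tendsto (fun n : ℕ => symbolExp U σ lam (t - n * T) t a) atTop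
      (𝓝 (symbolExpInf U σ lam t a)) := by
  have hint : IntegrableOn (integrand U σ lam t a) (Iic t) :=
    (integrableOn_Iic_iff_integrableOn_Iio (by simp)).2 (hint t a)
  have h1 : Tendsto (fun n : ℕ => t - n * T) atTop atBot := by
    simp_rw [sub_eq_add_neg]
    exact tendsto_atBot_add_const_left _ _
      (tendsto_neg_atTop_atBot.comp (tendsto_natCast_atTop_atTop.atTop_mul_const hT))
  have h2 := intervalIntegral_tendsto_integral_Iic t hint h1
  rw [integral_Iic_eq_integral_Iio] at h2
  exact (Complex.continuous_exp.tendsto _).comp h2.neg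

end SymbolExp

variable {H : Type*} [NormedAddCommGroup H] [InnerProductSpace ℝ H] [MeasurableSpace H]

lemma measureOfCharFun_spec {φ : H → ℂ}
    (h : ∃ μ : Measure H, IsProbabilityMeasure μ ∧ ∀ a, charFun μ a = φ a) :
    IsProbabilityMeasure (measureOfCharFun φ) ∧ ∀ a, charFun (measureOfCharFun φ) a = φ a := by
  rw [measureOfCharFun, dif_pos h]
  exact h.choose_spec

/-! ### The Mehler kernels as convolutions. -/

section Convolution

variable [BorelSpace H]

lemma lintegral_map_add_apply [SecondCountableTopology H] (μ ν : Measure H) [SFinite μ] [SFinite ν]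
    (L : H →L[ℝ] H) {B : Set H} (hB : MeasurableSet B) :
    ∫⁻ x, μ.map (fun y => y + L x) B ∂ν = (ν.map L ∗ μ) B := by
  rw [Measure.conv, Measure.map_apply (by fun_prop) hB, Measure.prod_apply (by measurability),
    lintegral_map (measurable_measure_prodMk_left (by measurability)) L.continuous.measurable]
  refine lintegral_congr fun x => ?_
  rw [Measure.map_apply (by fun_prop) hB]
  congr 1
  ext y
  simp [add_comm]

lemma charFun_map_continuousLinearMap [CompleteSpace H] (ν : Measure H) (L : H →L[ℝ] H) (a : H) :
    charFun (ν.map L) a = charFun ν (L.adjoint a) := by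
  rw [charFun_apply, charFun_apply, integral_map L.continuous.aemeasurable
    (Continuous.aestronglyMeasurable (by fun_prop))]
  simp_rw [ContinuousLinearMap.adjoint_inner_right]

end Convolution

/-! ### Existence of the measures; entrance laws in Fourier form. -/

section Existence

variable [CompleteSpace H] [BorelSpace H] [SecondCountableTopology H]
  {U : ℝ → ℝ → H →L[ℝ] H} {σ : ℝ → H →L[ℝ] H} {lam : H → ℂ}

/-- As the integrand is nonnegative, the exponent over `I` is at most that over `(-∞,t)`. Hence `1 -
exp(-∫_I)` is dominated by `1 - symbolExpInf`, which is small near `0` in the Sazonov topology. One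
argument thus covers `μ_{s,t}` and `μ_{-∞,t}`. -/
lemma exists_charFun_eq_exp_neg_setIntegral (H3 : IsLevySymbol lam)
    (H4 : HasLimitMeasures U σ lam) (H5 : ∀ a, lam a = conj (lam a)) {t : ℝ} {I : Set ℝ}
    (hI : I ⊆ Iio t) :
    ∃ μ : Measure H, IsProbabilityMeasure μ ∧
      ∀ a, charFun μ a = Complex.exp (-∫ r in I, integrand U σ lam t a r) := by
  have hint (a : H) : IntegrableOn (integrand U σ lam t a) I := (H4.integrable t a).mono_set hI
  have hneg : IsNegativeDefinite fun a => ∫ r in I, integrand U σ lam t a r :=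
    H3.negativeDefinite.integral (m := volume.restrict I)
      (fun r => (σ r).adjoint.comp (U r t).adjoint) hint
  have hzero (J : Set ℝ) : ∫ r in J, integrand U σ lam t 0 r = 0 := by
    simp [integrand, H3.zero]
  refine (hneg.exp_neg (hzero I)).exists_charFun_eq (by simp [hzero]) fun ε hε => ?_
  have hcont := H4.sazonov t
  have h1 := (@Continuous.tendsto H ℂ (sazonovTopology H) _ _ hcont 0).eventually
    (Metric.ball_mem_nhds _ hε)
  filter_upwards [h1] with a ha
  have h0 : symbolExpInf U σ lam t 0 = 1 := by simp [symbolExpInf, hzero]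
  rw [h0, dist_comm, dist_eq_norm] at ha
  refine le_trans ?_ ha.le
  have hre (J : Set ℝ) : ∃ x : ℝ, 0 ≤ x ∧ ∫ r in J, integrand U σ lam t a r = x := by
    have := integral_nonneg (μ := volume.restrict J) fun r =>
      integrand_nonneg (U := U) (σ := σ) H3 H5 t a r
    exact ⟨_, (Complex.le_def.1 this).1, Complex.ext rfl (Complex.le_def.1 this).2.symm⟩
  obtain ⟨x, hx0, hx⟩ := hre I
  obtain ⟨y, hy0, hy⟩ := hre (Iio t)
  have hxy : x ≤ y := by
    have : (x : ℂ) ≤ y := by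
      rw [← hx, ← hy]
      exact setIntegral_mono_set (H4.integrable t a)
        (ae_of_all _ fun r => integrand_nonneg H3 H5 t a r) (LE.le.eventuallyLE hI)
    exact_mod_cast this
  rw [symbolExpInf, hx, hy]
  have hnorm (z : ℝ) (hz : 0 ≤ z) : ‖1 - Complex.exp (-(z : ℂ))‖ = 1 - Real.exp (-z) := by
    rw [← Complex.ofReal_neg, ← Complex.ofReal_exp, ← Complex.ofReal_one, ← Complex.ofReal_sub,
      Complex.norm_real, Real.norm_eq_abs, abs_of_nonneg]
    rw [sub_nonneg, Real.exp_le_one_iff]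
    linarith
  rw [hnorm x hx0, hnorm y hy0]
  gcongr

lemma muInf_spec (H3 : IsLevySymbol lam) (H4 : HasLimitMeasures U σ lam)
    (H5 : ∀ a, lam a = conj (lam a)) (t : ℝ) :
    IsProbabilityMeasure (muInf U σ lam t) ∧
      ∀ a, charFun (muInf U σ lam t) a = symbolExpInf U σ lam t a :=
  measureOfCharFun_spec (exists_charFun_eq_exp_neg_setIntegral H3 H4 H5 Subset.rfl)

lemma mu_spec (H3 : IsLevySymbol lam) (H4 : HasLimitMeasures U σ lam)
    (H5 : ∀ a, lam a = conj (lam a)) {s t : ℝ} (hst : s ≤ t) :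
    IsProbabilityMeasure (mu U σ lam s t) ∧
      ∀ a, charFun (mu U σ lam s t) a = symbolExp U σ lam s t a := by
  refine measureOfCharFun_spec ?_
  obtain ⟨μ, hμ, h⟩ := exists_charFun_eq_exp_neg_setIntegral H3 H4 H5
    (Ioo_subset_Iio_self : Ioo s t ⊆ Iio t)
  refine ⟨μ, hμ, fun a => ?_⟩
  rw [h, symbolExp, intervalIntegral.integral_of_le hst, integral_Ioc_eq_integral_Ioo]

/-- Integrating the kernel against `ν s` gives `(ν s).map (U s t) ∗ μ_{s,t}`, and finite measures
are determined by their characteristic functions. -/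
lemma mem_entranceLaws_mehler_iff (H3 : IsLevySymbol lam) (H4 : HasLimitMeasures U σ lam)
    (H5 : ∀ a, lam a = conj (lam a)) {ν : ℝ → Measure H} (hν : ∀ t, IsProbabilityMeasure (ν t)) :
    ν ∈ entranceLaws (mehler U σ lam) ↔ ∀ s t, s ≤ t → ∀ a,
      charFun (ν t) a = charFun (ν s) ((U s t).adjoint a) * symbolExp U σ lam s t a := by
  have key {s t : ℝ} (hst : s ≤ t) (a : H) :
      charFun ((ν s).map (U s t) ∗ mu U σ lam s t) a =
        charFun (ν s) ((U s t).adjoint a) * symbolExp U σ lam s t a := by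
    have := (mu_spec H3 H4 H5 hst).1
    rw [charFun_conv, charFun_map_continuousLinearMap, (mu_spec H3 H4 H5 hst).2]
  have heq {s t : ℝ} (hst : s ≤ t) {B : Set H} (hB : MeasurableSet B) :
      ∫⁻ x, mehler U σ lam s t x B ∂(ν s) = ((ν s).map (U s t) ∗ mu U σ lam s t) B := by
    have := (mu_spec H3 H4 H5 hst).1
    exact lintegral_map_add_apply _ _ _ hB
  refine ⟨fun h s t hst a => ?_, fun h => ⟨hν, fun s t hst B hB => ?_⟩⟩
  · rw [← key hst]
    congr 1
    ext B hB
    rw [← h.2 s t hst B hB, heq hst hB]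
  · rw [heq hst hB]
    congr 1
    have := (mu_spec H3 H4 H5 hst).1
    have : IsProbabilityMeasure ((ν s).map (U s t)) :=
      Measure.isProbabilityMeasure_map (U s t).continuous.aemeasurable
    refine Measure.ext_of_charFun ?_
    ext a
    rw [key hst, h s t hst]

end Existence

end Mehler

theorem theorem4p1 {H : Type*} [NormedAddCommGroup H] [InnerProductSpace ℝ H] [CompleteSpace H]
    [TopologicalSpace.SeparableSpace H] [MeasurableSpace H] [BorelSpace H]
    (U : ℝ → ℝ → H →L[ℝ] H) (σ : ℝ → H →L[ℝ] H) (lam : H → ℂ)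
    (H1 : Mehler.IsEvolutionFamily U)
    (H2 : Mehler.IsBoundedCoefficient σ)
    (H3 : Mehler.IsLevySymbol lam)
    (H4 : Mehler.HasLimitMeasures U σ lam)
    (H5 : ∀ a, lam a = conj (lam a))
    (T : ℝ) (hT : 0 < T)
    (hUT : Mehler.PeriodicEvolution U T)
    (hσT : Function.Periodic σ T)
    (c ω : ℝ) (hc : 0 < c) (hω : 0 < ω)
    (hU : ∀ s t, s ≤ t → ‖U s t‖ ≤ c * Real.exp (-ω * (t - s))) :
    (Mehler.muInf U σ lam ∈ Mehler.entranceLaws1 (Mehler.mehler U σ lam) ∧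
      Function.Periodic (Mehler.muInf U σ lam) T) ∧
    ∀ ν ∈ Mehler.entranceLaws1 (Mehler.mehler U σ lam),
      Function.Periodic ν T → ν = Mehler.muInf U σ lam := by
  have : SecondCountableTopology H := UniformSpace.secondCountable_of_separable H
  have hinf := Mehler.muInf_spec H3 H4 H5
  refine ⟨⟨⟨?_, H4.moments⟩, fun t => ?_⟩, fun ν hν hνT => ?_⟩
  · rw [Mehler.mem_entranceLaws_mehler_iff H3 H4 H5 fun t => (hinf t).1]
    intro s t hst a
    rw [(hinf t).2, (hinf s).2, Mehler.symbolExpInf_eq_mul H1 H4.integrable hst]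
  -- The two characteristic functions are the same function, so the chosen measures agree.
  · rw [Mehler.muInf, Mehler.symbolExpInf_add_period hUT hσT, Mehler.muInf]
  · have hνp := hν.1.1
    have hνc := (Mehler.mem_entranceLaws_mehler_iff H3 H4 H5 hνp).1 hν.1
    funext t
    have := hνp t
    have := (hinf t).1
    refine Measure.ext_of_charFun (funext fun a => ?_)
    rw [(hinf t).2]
    have hle (n : ℕ) : t - n * T ≤ t := sub_le_self _ (by positivity)
    -- The adjoint has the same operator norm, so exponential stability applies to it.
    have h1 : Filter.Tendsto (fun n : ℕ => (U (t - n * T) t).adjoint a) Filter.atTop (nhds 0) := by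
      refine squeeze_zero_norm (a := fun n : ℕ => c * Real.exp (-ω * (n * T)) * ‖a‖)
        (fun n => ?_) ?_
      · refine (ContinuousLinearMap.le_opNorm _ _).trans ?_
        rw [LinearIsometryEquiv.norm_map]
        have := hU _ _ (hle n)
        rw [sub_sub_cancel] at this
        gcongr
      · have h2 : Filter.Tendsto (fun n : ℕ => -ω * (n * T)) Filter.atTop Filter.atBot :=
          (tendsto_natCast_atTop_atTop.atTop_mul_const hT).const_mul_atTop_of_neg (by linarith)
        simpa using ((Real.tendsto_exp_atBot.comp h2).const_mul c).mul_const ‖a‖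
    have h2 : Filter.Tendsto (fun n : ℕ => charFun (ν t) ((U (t - n * T) t).adjoint a))
        Filter.atTop (nhds 1) := by
      have hcont : Continuous (charFun (ν t)) := by fun_prop
      have h3 := (hcont.tendsto 0).comp h1
      rwa [charFun_zero, probReal_univ, Complex.ofReal_one] at h3
    have h3 := h2.mul (Mehler.tendsto_symbolExp_sub_nat_mul H4.integrable hT t a)
    rw [one_mul] at h3
    -- By periodicity `ν (t - n * T) = ν t`, so the product in `h3` equals `charFun (ν t) a` for
    -- every `n`.
    refine tendsto_nhds_unique (tendsto_const_nhds.congr fun n => ?_) h3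
    rw [hνc _ _ (hle n) a, hνT.sub_nat_mul_eq n]
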